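/- Let $\theta\in\mathbb R$ and $\lambda=e^{2\pi i\theta}$. Let $A$ be the universal unital $C^*$-algebra generated by two isometries $u,v$ (i.e. $u^*u=v^*v=1$) with $uv=\lambda vu$ (the free twist of two isometries), and let $J=\langle 1-uu^*,\,1-vv^*\rangle$ be the closed two-sided ideal of $A$ generated by $1-uu^*$ and $1-vv^*$. Put $\bar u=u(1-vv^*)+(1-uu^*)v^*\in A$ and $\bar p=v(1-uu^*)v^*\in A$. Let $C(S^1)*_{\mathbb C}\mathbb C^2$ be the unital free product of $C^*$-algebras; denote again by $\bar u$ its unitary given by the identity function $z\in C(S^1)$, and by $\bar p$ its projection given by $(1,0)\in\mathbb C^2$. Let $\mathcal K$ be the $C^*$-algebra of compact operators on $\ell^2(\mathbb N_0)$ with standard orthonormal basis $(e_i)_{i\ge 0}$, and for $i\in\mathbb N_0$ let $x_i\in\mathcal K$ be the rank-one partial isometry $\xi\mapsto\langle e_0,\xi\rangle e_i$ (inner product linear in the second variable). Then there is a $*$-isomorphism $$J\;\cong\;\bigl(C(S^1)*_{\mathbb C}\mathbb C^2\bigr)\otimes\mathcal K$$ under which, for every $i\in\mathbb N_0$, $(uv)^i\bar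 u\in J$ corresponds to $\bar u\otimes x_i$ and $(uv)^i\bar p\in J$ corresponds to $\bar p\otimes x_i$. -/

import Mathlib

open scoped ComplexConjugate

noncomputable section

namespace TwistedIsometries

universe u

/-! ### Noncommutative *-polynomials -/

/-- The unital involutive algebra of noncommutative polynomials in `G ∪ G*`: the left copy of `G`
is the set of generators, the right copy the set of their adjoints. -/
def StarPoly (G : Type u) : Type u := FreeAlgebra ℂ (G ⊕ G)

namespace StarPoly

variable {G : Type u}

instance : Ring (StarPoly G) := inferInstanceAs (Ring (FreeAlgebra ℂ (G ⊕ G)))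

instance : Algebra ℂ (StarPoly G) := inferInstanceAs (Algebra ℂ (FreeAlgebra ℂ (G ⊕ G)))

/-- The generator `x_g`. -/
def gen (g : G) : StarPoly G := FreeAlgebra.ι ℂ (Sum.inl g)

/-- The formal adjoint `x_g*`. -/
def genStar (g : G) : StarPoly G := FreeAlgebra.ι ℂ (Sum.inr g)

/-- The unital algebra homomorphism with prescribed values on the generators and on their formal
adjoints. -/
def liftAlg {B : Type*} [Ring B] [Algebra ℂ B] (f : G ⊕ G → B) : StarPoly G →ₐ[ℂ] B :=
  FreeAlgebra.lift ℂ f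

theorem liftAlg_gen {B : Type*} [Ring B] [Algebra ℂ B] (f : G ⊕ G → B) (g : G) :
    liftAlg f (gen g) = f (Sum.inl g) :=
  FreeAlgebra.lift_ι_apply _ _

theorem liftAlg_genStar {B : Type*} [Ring B] [Algebra ℂ B] (f : G ⊕ G → B) (g : G) :
    liftAlg f (genStar g) = f (Sum.inr g) :=
  FreeAlgebra.lift_ι_apply _ _

theorem induction {C : StarPoly G → Prop} (hs : ∀ r : ℂ, C (algebraMap ℂ _ r))
    (hg : ∀ g, C (gen g)) (hg' : ∀ g, C (genStar g)) (hm : ∀ a b, C a → C b → C (a * b))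
    (ha : ∀ a b, C a → C b → C (a + b)) (p : StarPoly G) : C p :=
  FreeAlgebra.induction (R := ℂ) (X := G ⊕ G) (motive := C) hs
    (fun x => match x with
      | Sum.inl g => hg g
      | Sum.inr g => hg' g) hm ha p

/-- The opposite of the polynomial algebra, with scalars acting through complex conjugation. -/
def ConjOp (G : Type u) : Type u := (StarPoly G)ᵐᵒᵖ

instance : Ring (ConjOp G) := inferInstanceAs (Ring (StarPoly G)ᵐᵒᵖ)

instance : Algebra ℂ (ConjOp G) :=
  RingHom.toAlgebra' ((algebraMap ℂ (StarPoly G)ᵐᵒᵖ).comp (starRingEnd ℂ))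
    (fun c x => Algebra.commutes (A := (StarPoly G)ᵐᵒᵖ) (conj c) x)

/-- The involution of `StarPoly G` as an algebra homomorphism into the conjugate opposite algebra;
it exchanges `x_g` and `x_g*`. -/
def starHom (G : Type u) : StarPoly G →ₐ[ℂ] ConjOp G :=
  liftAlg (B := ConjOp G)
    (Sum.elim (fun g => MulOpposite.op (genStar g)) (fun g => MulOpposite.op (gen g)))

/-- The involution: conjugate linear, antimultiplicative, with `(x_g)* = x_g*`. -/
instance : Star (StarPoly G) := ⟨fun p => MulOpposite.unop (starHom G p : (StarPoly G)ᵐᵒᵖ)⟩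

theorem star_def (p : StarPoly G) :
    star p = MulOpposite.unop (starHom G p : (StarPoly G)ᵐᵒᵖ) := rfl

@[simp] theorem star_gen (g : G) : star (gen g) = genStar g := by
  rw [star_def, starHom, liftAlg_gen]; rfl

@[simp] theorem star_genStar (g : G) : star (genStar g) = gen g := by
  rw [star_def, starHom, liftAlg_genStar]; rfl

theorem star_mul' (p q : StarPoly G) : star (p * q) = star q * star p := by
  rw [star_def, map_mul]; rfl

theorem star_add' (p q : StarPoly G) : star (p + q) = star p + star q := by
  rw [star_def, map_add]; rfl

theorem star_algebraMap' (c : ℂ) :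
    star (algebraMap ℂ (StarPoly G) c) = algebraMap ℂ (StarPoly G) (conj c) := by
  rw [star_def, AlgHom.commutes]; rfl

instance : StarRing (StarPoly G) where
  star_involutive p := by
    induction p using StarPoly.induction with
    | hs r => rw [star_algebraMap', star_algebraMap', Complex.conj_conj]
    | hg g => simp
    | hg' g => simp
    | hm a b h1 h2 => rw [star_mul', star_mul', h1, h2]
    | ha a b h1 h2 => rw [star_add', star_add', h1, h2]
  star_mul := star_mul'
  star_add := star_add'

instance : StarModule ℂ (StarPoly G) where
  star_smul c p := by
    rw [Algebra.smul_def, star_mul', star_algebraMap', Algebra.smul_def, Algebra.commutes]; rfl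

/-- Evaluation of a noncommutative *-polynomial at a family of elements of a *-algebra:
`x_g ↦ y g` and `x_g* ↦ (y g)*`. -/
def eval {B : Type*} [Ring B] [Algebra ℂ B] [Star B] (y : G → B) : StarPoly G →ₐ[ℂ] B :=
  liftAlg (Sum.elim y fun g => star (y g))

@[simp] theorem eval_gen {B : Type*} [Ring B] [Algebra ℂ B] [Star B] (y : G → B) (g : G) :
    eval y (gen g) = y g :=
  liftAlg_gen _ _

@[simp] theorem eval_genStar {B : Type*} [Ring B] [Algebra ℂ B] [Star B] (y : G → B) (g : G) :
    eval y (genStar g) = star (y g) :=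
  liftAlg_genStar _ _

@[simp] theorem eval_star {B : Type*} [Ring B] [Algebra ℂ B] [StarRing B] [StarModule ℂ B]
    (y : G → B) (p : StarPoly G) : eval y (star p) = star (eval y p) := by
  induction p using StarPoly.induction with
  | hs r =>
    rw [star_algebraMap', AlgHom.commutes, AlgHom.commutes, ← algebraMap_star_comm]; rfl
  | hg g => simp
  | hg' g => simp
  | hm a b h1 h2 => rw [star_mul', map_mul, map_mul, star_mul, h1, h2]
  | ha a b h1 h2 => rw [star_add', map_add, map_add, star_add, h1, h2]

end StarPoly

/-! ### Universal unital C*-algebras -/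

section Universal

variable {G : Type u}

/-- A representation of the generators `G` and relations `R` in a unital C*-algebra `B`. -/
def IsRep (R : Set (StarPoly G)) {B : Type u} [CStarAlgebra B] (y : G → B) : Prop :=
  ∀ r ∈ R, StarPoly.eval y r = 0

/-- The set of all norms of `p` in representations of `(G, R)`. -/
def repNorms (R : Set (StarPoly G)) (p : StarPoly G) : Set ℝ :=
  {t | ∃ (B : Type u) (_ : CStarAlgebra B) (y : G → B), IsRep R y ∧ t = ‖StarPoly.eval y p‖}

/-- The relations bound the norm of every generator; this is what is needed for the universal
C*-algebra to exist. -/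
class BoundedRelations (R : Set (StarPoly G)) : Prop where
  bound : ∀ g : G, ∃ C : ℝ, ∀ (B : Type u) [CStarAlgebra B] (y : G → B), IsRep R y → ‖y g‖ ≤ C

variable (R : Set (StarPoly G))

theorem repNorms_nonempty (p : StarPoly G) : (repNorms R p).Nonempty :=
  ⟨_, C(PEmpty.{u + 1}, ℂ), inferInstance, fun _ => 0, fun _ _ => Subsingleton.elim _ _, rfl⟩

theorem exists_bound [h : BoundedRelations R] (p : StarPoly G) :
    ∃ C : ℝ, ∀ (B : Type u) [CStarAlgebra B] (y : G → B), IsRep R y →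
      ‖StarPoly.eval y p‖ ≤ C := by
  induction p using StarPoly.induction with
  | hs r =>
    refine ⟨‖r‖, fun B _ y _ => ?_⟩
    rw [AlgHom.commutes, Algebra.algebraMap_eq_smul_one, norm_smul]
    refine mul_le_of_le_one_right (norm_nonneg r) ?_
    have h1 := CStarRing.norm_star_mul_self (x := (1 : B))
    rw [star_one, one_mul] at h1
    nlinarith [norm_nonneg (1 : B), sq_nonneg (‖(1 : B)‖ - 1)]
  | hg g =>
    obtain ⟨C, hC⟩ := h.bound g
    exact ⟨C, fun B _ y hy => by rw [StarPoly.eval_gen]; exact hC B y hy⟩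
  | hg' g =>
    obtain ⟨C, hC⟩ := h.bound g
    exact ⟨C, fun B _ y hy => by rw [StarPoly.eval_genStar, norm_star]; exact hC B y hy⟩
  | hm a b h1 h2 =>
    obtain ⟨C, hC⟩ := h1
    obtain ⟨D, hD⟩ := h2
    refine ⟨C * D, fun B _ y hy => ?_⟩
    rw [map_mul]
    exact (norm_mul_le _ _).trans (mul_le_mul (hC B y hy) (hD B y hy) (norm_nonneg _)
      ((norm_nonneg _).trans (hC B y hy)))
  | ha a b h1 h2 =>
    obtain ⟨C, hC⟩ := h1
    obtain ⟨D, hD⟩ := h2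
    refine ⟨C + D, fun B _ y hy => ?_⟩
    rw [map_add]
    exact (norm_add_le _ _).trans (add_le_add (hC B y hy) (hD B y hy))

theorem bddAbove_repNorms [BoundedRelations R] (p : StarPoly G) : BddAbove (repNorms R p) := by
  obtain ⟨C, hC⟩ := exists_bound R p
  refine ⟨C, ?_⟩
  rintro t ⟨B, _, y, hy, rfl⟩
  exact hC B y hy

/-- The largest C*-seminorm compatible with the relations: the supremum of the norms in all
representations of `(G, R)`. -/
def univNorm (p : StarPoly G) : ℝ := sSup (repNorms R p)

theorem le_univNorm [BoundedRelations R] {B : Type u} [CStarAlgebra B] {y : G → B}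
    (hy : IsRep R y) (p : StarPoly G) : ‖StarPoly.eval y p‖ ≤ univNorm R p :=
  le_csSup (bddAbove_repNorms R p) ⟨B, _, y, hy, rfl⟩

theorem univNorm_le {p : StarPoly G} {C : ℝ}
    (h : ∀ (B : Type u) [CStarAlgebra B] (y : G → B), IsRep R y → ‖StarPoly.eval y p‖ ≤ C) :
    univNorm R p ≤ C := by
  refine csSup_le (repNorms_nonempty R p) ?_
  rintro t ⟨B, _, y, hy, rfl⟩
  exact h B y hy

theorem univNorm_nonneg [BoundedRelations R] (p : StarPoly G) : 0 ≤ univNorm R p := by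
  refine le_trans (norm_nonneg _)
    (le_univNorm (B := C(PEmpty.{u + 1}, ℂ)) R (y := fun _ => 0) ?_ p)
  exact fun _ _ => Subsingleton.elim _ _

/-- The *-algebra of noncommutative polynomials, carrying the universal C*-seminorm. -/
def PreUniv (R : Set (StarPoly G)) : Type u := let _ := R; StarPoly G

instance : Ring (PreUniv R) := inferInstanceAs (Ring (StarPoly G))

instance : Algebra ℂ (PreUniv R) := inferInstanceAs (Algebra ℂ (StarPoly G))

instance : StarRing (PreUniv R) := inferInstanceAs (StarRing (StarPoly G))

instance : StarModule ℂ (PreUniv R) := inferInstanceAs (StarModule ℂ (StarPoly G))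

variable [BoundedRelations R]

/-- `univNorm R` as a ring seminorm. -/
def univSeminorm : RingSeminorm (PreUniv R) where
  toFun := univNorm R
  map_zero' := by
    refine le_antisymm (univNorm_le R fun B _ y _ => ?_) (univNorm_nonneg R _)
    exact (congrArg norm (map_zero (StarPoly.eval y))).le.trans norm_zero.le
  add_le' p q := by
    refine univNorm_le R fun B _ y hy => ?_
    refine (congrArg norm (map_add (StarPoly.eval y) p q)).le.trans ((norm_add_le _ _).trans ?_)
    exact add_le_add (le_univNorm R hy _) (le_univNorm R hy _)
  neg' p := by
    refine congrArg sSup (Set.ext fun t => ?_)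
    have : ∀ (B : Type u) [CStarAlgebra B] (y : G → B),
        ‖StarPoly.eval y (-p : StarPoly G)‖ = ‖StarPoly.eval y (p : StarPoly G)‖ :=
      fun B _ y => (congrArg norm (map_neg (StarPoly.eval y) p)).trans (norm_neg _)
    constructor
    · rintro ⟨B, i, y, hy, rfl⟩
      exact ⟨B, i, y, hy, this B y⟩
    · rintro ⟨B, i, y, hy, rfl⟩
      exact ⟨B, i, y, hy, (this B y).symm⟩
  mul_le' p q := by
    refine univNorm_le R fun B _ y hy => ?_
    refine (congrArg norm (map_mul (StarPoly.eval y) p q)).le.trans ((norm_mul_le _ _).trans ?_)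
    exact mul_le_mul (le_univNorm R hy _) (le_univNorm R hy _) (norm_nonneg _)
      (univNorm_nonneg R _)

instance : SeminormedRing (PreUniv R) := (univSeminorm R).toSeminormedRing

theorem PreUniv.norm_def (p : PreUniv R) : ‖p‖ = univNorm R p := rfl

theorem PreUniv.norm_smul_le' (c : ℂ) (p : PreUniv R) : ‖c • p‖ ≤ ‖c‖ * ‖p‖ := by
  refine univNorm_le R fun B _ y hy => ?_
  refine (congrArg norm (map_smul (StarPoly.eval y) c (p : StarPoly G))).le.trans ?_
  rw [norm_smul]
  exact mul_le_mul_of_nonneg_left (le_univNorm R hy _) (norm_nonneg c)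

instance : NormedAlgebra ℂ (PreUniv R) where
  norm_smul_le := PreUniv.norm_smul_le' R

theorem PreUniv.norm_star_le (p : PreUniv R) : ‖star p‖ ≤ ‖p‖ := by
  refine univNorm_le R fun B _ y hy => ?_
  refine (congrArg norm (StarPoly.eval_star y (p : StarPoly G))).le.trans ?_
  rw [norm_star]
  exact le_univNorm R hy _

theorem PreUniv.norm_sq_le (p : PreUniv R) : ‖p‖ * ‖p‖ ≤ ‖star p * p‖ := by
  have h : ‖p‖ ≤ Real.sqrt ‖star p * p‖ := by
    refine univNorm_le R fun B _ y hy => Real.le_sqrt_of_sq_le ?_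
    have h1 : StarPoly.eval y (star p * p : PreUniv R) =
        star (StarPoly.eval y (p : StarPoly G)) * StarPoly.eval y (p : StarPoly G) :=
      (map_mul (StarPoly.eval y) (star p : StarPoly G) p).trans
        (congrArg (· * StarPoly.eval y (p : StarPoly G)) (StarPoly.eval_star y p))
    rw [sq, ← CStarRing.norm_star_mul_self, ← h1]
    exact le_univNorm R hy _
  calc ‖p‖ * ‖p‖ ≤ Real.sqrt ‖star p * p‖ * Real.sqrt ‖star p * p‖ :=
        mul_self_le_mul_self (norm_nonneg p) h
    _ = ‖star p * p‖ := Real.mul_self_sqrt (norm_nonneg _)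

theorem PreUniv.norm_star (p : PreUniv R) : ‖star p‖ = ‖p‖ := by
  refine le_antisymm (PreUniv.norm_star_le R p) ?_
  have := PreUniv.norm_star_le R (star p)
  rwa [star_star] at this

theorem PreUniv.isometry_star : Isometry (star : PreUniv R → PreUniv R) :=
  Isometry.of_dist_eq fun p q => by
    rw [dist_eq_norm, dist_eq_norm, ← star_sub, PreUniv.norm_star]

/-- The universal unital C*-algebra `C*(G | R)`: the Hausdorff completion of the noncommutative
*-polynomials in `G` with respect to the universal C*-seminorm. -/
def UnivCStar : Type u := UniformSpace.Completion (PreUniv R)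

namespace UnivCStar

open UniformSpace

instance : NormedRing (UnivCStar R) := inferInstanceAs (NormedRing (Completion (PreUniv R)))

instance : Algebra ℂ (UnivCStar R) := inferInstanceAs (Algebra ℂ (Completion (PreUniv R)))

instance : NormedAlgebra ℂ (UnivCStar R) where
  norm_smul_le := norm_smul_le (α := ℂ) (β := Completion (PreUniv R))

instance : CompleteSpace (UnivCStar R) :=
  inferInstanceAs (CompleteSpace (Completion (PreUniv R)))

/-- The class of a polynomial in the universal C*-algebra. -/
def mk (p : StarPoly G) : UnivCStar R := Completion.coe' (α := PreUniv R) p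

instance : Star (UnivCStar R) := ⟨Completion.map (star : PreUniv R → PreUniv R)⟩

theorem continuous_star' : Continuous (star : UnivCStar R → UnivCStar R) :=
  Completion.continuous_map

theorem induction {C : UnivCStar R → Prop} (hc : IsClosed {a | C a}) (h : ∀ p, C (mk R p))
    (a : UnivCStar R) : C a :=
  Completion.induction_on (α := PreUniv R) (p := C) a hc h

theorem mk_add (p q : StarPoly G) : mk R (p + q) = mk R p + mk R q :=
  Completion.coe_add (α := PreUniv R) p q

theorem mk_sub (p q : StarPoly G) : mk R (p - q) = mk R p - mk R q :=
  Completion.coe_sub (α := PreUniv R) p q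

theorem mk_mul (p q : StarPoly G) : mk R (p * q) = mk R p * mk R q :=
  Completion.coe_mul (α := PreUniv R) p q

theorem mk_one : mk R 1 = 1 := rfl

theorem mk_smul (c : ℂ) (p : StarPoly G) : mk R (c • p) = c • mk R p :=
  Completion.coe_smul (X := PreUniv R) c p

theorem mk_star (p : StarPoly G) : mk R (star p) = star (mk R p) :=
  (Completion.map_coe (PreUniv.isometry_star R).uniformContinuous (p : PreUniv R)).symm

theorem norm_mk (p : StarPoly G) : ‖mk R p‖ = univNorm R p :=
  Completion.norm_coe (E := PreUniv R) p

instance : StarRing (UnivCStar R) where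
  star_involutive a := by
    refine induction R (C := fun a => star (star a) = a) ?_ (fun p => ?_) a
    · exact isClosed_eq ((continuous_star' R).comp (continuous_star' R)) continuous_id
    · rw [← mk_star, ← mk_star, star_star]
  star_mul a b := by
    refine induction R (C := fun a => star (a * b) = star b * star a) ?_ (fun p => ?_) a
    · exact isClosed_eq ((continuous_star' R).comp (continuous_id.mul continuous_const))
        (continuous_const.mul (continuous_star' R))
    · refine induction R (C := fun b => star (mk R p * b) = star b * star (mk R p)) ?_
        (fun q => ?_) b
      · exact isClosed_eq ((continuous_star' R).comp (continuous_const.mul continuous_id))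
          ((continuous_star' R).mul continuous_const)
      · rw [← mk_mul, ← mk_star, ← mk_star, ← mk_star, ← mk_mul, star_mul]
  star_add a b := by
    refine induction R (C := fun a => star (a + b) = star a + star b) ?_ (fun p => ?_) a
    · exact isClosed_eq ((continuous_star' R).comp (continuous_id.add continuous_const))
        ((continuous_star' R).add continuous_const)
    · refine induction R (C := fun b => star (mk R p + b) = star (mk R p) + star b) ?_
        (fun q => ?_) b
      · exact isClosed_eq ((continuous_star' R).comp (continuous_const.add continuous_id))
          (continuous_const.add (continuous_star' R))
      · rw [← mk_add, ← mk_star, ← mk_star, ← mk_star, ← mk_add, star_add]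

instance : CStarRing (UnivCStar R) where
  norm_mul_self_le a := by
    refine induction R (C := fun a => ‖a‖ * ‖a‖ ≤ ‖star a * a‖) ?_ (fun p => ?_) a
    · exact isClosed_le (continuous_norm.mul continuous_norm)
        (((continuous_star' R).mul continuous_id).norm)
    · rw [← mk_star, ← mk_mul, norm_mk, norm_mk]
      exact PreUniv.norm_sq_le R p

instance : StarModule ℂ (UnivCStar R) where
  star_smul c a := by
    refine induction R (C := fun a => star (c • a) = star c • star a) ?_ (fun p => ?_) a
    · exact isClosed_eq ((continuous_star' R).comp (continuous_const_smul c))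
        ((continuous_star' R).const_smul (star c))
    · rw [← mk_smul, ← mk_star, ← mk_star, ← mk_smul, star_smul]

instance : CStarAlgebra (UnivCStar R) where

/-- The image of a generator in the universal C*-algebra. -/
def of (g : G) : UnivCStar R := mk R (StarPoly.gen g)

theorem mk_gen (g : G) : mk R (StarPoly.gen g) = of R g := rfl

theorem mk_genStar (g : G) : mk R (StarPoly.genStar g) = star (of R g) := by
  rw [← StarPoly.star_gen, mk_star, mk_gen]

/-- The relations hold in the universal C*-algebra. -/
theorem mk_eq_zero {r : StarPoly G} (hr : r ∈ R) : mk R r = 0 := by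
  rw [← norm_eq_zero, norm_mk]
  refine le_antisymm (univNorm_le R fun B _ y hy => ?_) (univNorm_nonneg R _)
  rw [hy r hr, norm_zero]

end UnivCStar

end Universal

/-! ### Closed ideals -/

section ClosedIdeal

variable {A : Type*} [CStarAlgebra A]

theorem star_mem_span {s : Set A} (hs : ∀ x ∈ s, star x ∈ s) {x : A}
    (hx : x ∈ TwoSidedIdeal.span s) : star x ∈ TwoSidedIdeal.span s := by
  induction hx using TwoSidedIdeal.span_induction with
  | mem x h => exact TwoSidedIdeal.subset_span (hs x h)
  | zero => rw [star_zero]; exact TwoSidedIdeal.zero_mem _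
  | add x y _ _ h1 h2 => rw [star_add]; exact TwoSidedIdeal.add_mem _ h1 h2
  | neg x _ h => rw [star_neg]; exact TwoSidedIdeal.neg_mem _ h
  | left_absorb a x _ h => rw [star_mul]; exact TwoSidedIdeal.mul_mem_right _ _ _ h
  | right_absorb a x _ h => rw [star_mul]; exact TwoSidedIdeal.mul_mem_left _ _ _ h

/-- The closed two-sided ideal generated by a self-adjoint subset `s` of a C*-algebra, as a
C*-subalgebra. -/
def closedIdeal (s : Set A) (hs : ∀ x ∈ s, star x ∈ s) : NonUnitalStarSubalgebra ℂ A where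
  carrier := closure (TwoSidedIdeal.span s : Set A)
  add_mem' ha hb := map_mem_closure₂ continuous_add ha hb fun _ h _ h' =>
    TwoSidedIdeal.add_mem _ h h'
  zero_mem' := subset_closure (TwoSidedIdeal.zero_mem _)
  mul_mem' ha hb := map_mem_closure₂ continuous_mul ha hb fun _ _ _ h' =>
    TwoSidedIdeal.mul_mem_left _ _ _ h'
  smul_mem' c _ ha := map_mem_closure (continuous_const_smul c) ha fun x h => by
    have := TwoSidedIdeal.mul_mem_left _ (algebraMap ℂ A c) _ h
    rwa [← Algebra.smul_def] at this
  star_mem' ha := map_mem_closure continuous_star ha fun _ h => star_mem_span hs h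

instance (s : Set A) (hs : ∀ x ∈ s, star x ∈ s) : IsClosed (closedIdeal s hs : Set A) :=
  isClosed_closure

theorem subset_closedIdeal (s : Set A) (hs : ∀ x ∈ s, star x ∈ s) :
    s ⊆ (closedIdeal s hs : Set A) :=
  TwoSidedIdeal.subset_span.trans subset_closure

end ClosedIdeal

/-! ### The free twist of two isometries and its defect ideal -/

/-- The relations of the free twist; the generators are `u = gen false` and `v = gen true`. -/
def freeTwistRels (θ : ℝ) : Set (StarPoly Bool) :=
  {star (.gen false) * .gen false - 1,
   star (.gen true) * .gen true - 1,
   .gen false * .gen true -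
    Complex.exp (2 * Real.pi * Complex.I * θ) • (.gen true * .gen false)}

instance (θ : ℝ) : BoundedRelations (freeTwistRels θ) where
  bound g := by
    refine ⟨1, fun B _ y hy => ?_⟩
    have h : star (y g) * y g = 1 := by
      cases g
      · have := hy (star (.gen false) * .gen false - 1) (by simp [freeTwistRels])
        simpa [sub_eq_zero] using this
      · have := hy (star (.gen true) * .gen true - 1) (by simp [freeTwistRels])
        simpa [sub_eq_zero] using this
    have h1 := CStarRing.norm_star_mul_self (x := y g)
    have h2 := CStarRing.norm_star_mul_self (x := (1 : B))
    rw [h] at h1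
    rw [star_one, one_mul] at h2
    nlinarith [norm_nonneg (1 : B), norm_nonneg (y g), sq_nonneg (‖(1 : B)‖ - 1)]

/-- The free twist: the universal unital C*-algebra generated by two isometries `u`, `v` with
`u v = e^{2πiθ} v u`. -/
abbrev FreeTwist (θ : ℝ) : Type := UnivCStar (freeTwistRels θ)

namespace FreeTwist

/-- The isometry `u`. -/
def u (θ : ℝ) : FreeTwist θ := UnivCStar.of _ false

/-- The isometry `v`. -/
def v (θ : ℝ) : FreeTwist θ := UnivCStar.of _ true

/-- The defect ideal `J = ⟨1 - u u*, 1 - v v*⟩`, as a closed two-sided ideal. -/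
def defectIdeal (θ : ℝ) : NonUnitalStarSubalgebra ℂ (FreeTwist θ) :=
  closedIdeal {1 - u θ * star (u θ), 1 - v θ * star (v θ)} (by
    rintro x (rfl | rfl)
    · left; simp
    · right; simp)

/-- `ū = u (1 - v v*) + (1 - u u*) v*`. -/
def ubar (θ : ℝ) : FreeTwist θ :=
  u θ * (1 - v θ * star (v θ)) + (1 - u θ * star (u θ)) * star (v θ)

/-- `p̄ = v (1 - u u*) v*`. -/
def pbar (θ : ℝ) : FreeTwist θ := v θ * (1 - u θ * star (u θ)) * star (v θ)

end FreeTwist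

/-! ### Unital free products and tensor products -/

section Products

variable {A G : Type u} [NonUnitalCStarAlgebra A]

/-- The relations of the C*-algebra `A` on its copy `j '' A` among the generators `G`, that is,
the relations expressing that `j` is a *-homomorphism. -/
def algebraRels (j : A → G) : Set (StarPoly G) :=
  {r | ∃ a b : A, r = .gen (j (a + b)) - (.gen (j a) + .gen (j b))} ∪
  {r | ∃ (c : ℂ) (a : A), r = .gen (j (c • a)) - c • .gen (j a)} ∪
  {r | ∃ a b : A, r = .gen (j (a * b)) - .gen (j a) * .gen (j b)} ∪
  {r | ∃ a : A, r = .gen (j (star a)) - star (.gen (j a))}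

theorem norm_le_of_algebraRels {j : A → G} {R : Set (StarPoly G)} (hR : algebraRels j ⊆ R)
    {B : Type u} [CStarAlgebra B] {y : G → B} (hy : IsRep R y) (a : A) : ‖y (j a)‖ ≤ ‖a‖ := by
  have hadd : ∀ a b : A, y (j (a + b)) = y (j a) + y (j b) := fun a b => by
    simpa [sub_eq_zero] using hy _ (hR (.inl (.inl (.inl ⟨a, b, rfl⟩))))
  have hsmul : ∀ (c : ℂ) (a : A), y (j (c • a)) = c • y (j a) := fun c a => by
    simpa [sub_eq_zero] using hy _ (hR (.inl (.inl (.inr ⟨c, a, rfl⟩))))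
  have hmul : ∀ a b : A, y (j (a * b)) = y (j a) * y (j b) := fun a b => by
    simpa [sub_eq_zero] using hy _ (hR (.inl (.inr ⟨a, b, rfl⟩)))
  have hstar : ∀ a : A, y (j (star a)) = star (y (j a)) := fun a => by
    simpa [sub_eq_zero] using hy _ (hR (.inr ⟨a, rfl⟩))
  let φ : A →⋆ₙₐ[ℂ] B :=
    { toFun := fun a => y (j a)
      map_smul' := hsmul
      map_zero' := by simpa using hsmul 0 0
      map_add' := hadd
      map_mul' := hmul
      map_star' := hstar }
  exact NonUnitalStarAlgHom.norm_apply_le φ a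

end Products

section FreeProduct

variable (A B : Type u) [CStarAlgebra A] [CStarAlgebra B]

/-- The relations of the unital free product: those of `A`, those of `B`, and the identification
of both units with the unit. -/
def freeProductRels : Set (StarPoly (A ⊕ B)) :=
  algebraRels (Sum.inl : A → A ⊕ B) ∪ algebraRels (Sum.inr : B → A ⊕ B) ∪
    {.gen (Sum.inl 1) - 1, .gen (Sum.inr 1) - 1}

instance : BoundedRelations (freeProductRels A B) where
  bound
    | Sum.inl a => ⟨‖a‖, fun _ _ _ hy =>
        norm_le_of_algebraRels (fun _ h => .inl (.inl h)) hy a⟩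
    | Sum.inr b => ⟨‖b‖, fun _ _ _ hy =>
        norm_le_of_algebraRels (fun _ h => .inl (.inr h)) hy b⟩

/-- The unital free product `A *_ℂ B` of unital C*-algebras. -/
abbrev FreeProduct : Type u := UnivCStar (freeProductRels A B)

variable {A B}

/-- The canonical map `A → A *_ℂ B`. -/
def FreeProduct.inl (a : A) : FreeProduct A B := UnivCStar.of _ (Sum.inl a)

/-- The canonical map `B → A *_ℂ B`. -/
def FreeProduct.inr (b : B) : FreeProduct A B := UnivCStar.of _ (Sum.inr b)

end FreeProduct

section Tensor

variable (A B : Type u) [CStarAlgebra A] [NonUnitalCStarAlgebra B]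

/-- The relations of the unital C*-algebra generated by commuting copies of a unital C*-algebra `A`
and a (possibly non-unital) C*-algebra `B`, the unit of `A` being identified with the unit. -/
def tensorRels : Set (StarPoly (A ⊕ B)) :=
  algebraRels (Sum.inl : A → A ⊕ B) ∪ algebraRels (Sum.inr : B → A ⊕ B) ∪
    {.gen (Sum.inl 1) - 1} ∪
    {r | ∃ (a : A) (b : B), r =
      .gen (Sum.inl a) * .gen (Sum.inr b) - .gen (Sum.inr b) * .gen (Sum.inl a)}

instance : BoundedRelations (tensorRels A B) where
  bound
    | Sum.inl a => ⟨‖a‖, fun _ _ _ hy =>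
        norm_le_of_algebraRels (fun _ h => .inl (.inl (.inl h))) hy a⟩
    | Sum.inr b => ⟨‖b‖, fun _ _ _ hy =>
        norm_le_of_algebraRels (fun _ h => .inl (.inl (.inr h))) hy b⟩

/-- The universal unital C*-algebra generated by commuting copies of `A` and `B`. -/
abbrev TensorAmbient : Type u := UnivCStar (tensorRels A B)

variable {A B}

/-- The product of the images of `a` and `b` in the ambient algebra. -/
def preTmul (a : A) (b : B) : TensorAmbient A B :=
  UnivCStar.of _ (Sum.inl a) * UnivCStar.of _ (Sum.inr b)

theorem star_preTmul (a : A) (b : B) :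
    star (preTmul a b) = preTmul (star a) (star b) := by
  have ha := UnivCStar.mk_eq_zero (tensorRels A B)
    (.inl (.inl (.inl (.inr ⟨a, rfl⟩))))
  have hb := UnivCStar.mk_eq_zero (tensorRels A B)
    (.inl (.inl (.inr (.inr ⟨b, rfl⟩))))
  have hc := UnivCStar.mk_eq_zero (tensorRels A B) (.inr ⟨star a, star b, rfl⟩)
  rw [UnivCStar.mk_sub, sub_eq_zero] at ha hb hc
  rw [UnivCStar.mk_mul, UnivCStar.mk_mul] at hc
  rw [UnivCStar.mk_star] at ha hb
  simp only [UnivCStar.mk_gen] at ha hb hc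
  rw [preTmul, preTmul, star_mul, ← ha, ← hb, hc]

variable (A B)

/-- The (maximal) C*-tensor product `A ⊗ B` of a unital C*-algebra `A` and a C*-algebra `B`: the
closed ideal generated by all products `a b` in the universal C*-algebra generated by commuting
copies of `A` and `B`. -/
def CStarTensor : NonUnitalStarSubalgebra ℂ (TensorAmbient A B) :=
  closedIdeal {x | ∃ (a : A) (b : B), x = preTmul a b} (by
    rintro _ ⟨a, b, rfl⟩
    exact ⟨star a, star b, star_preTmul a b⟩)

variable {A B}

/-- The elementary tensor `a ⊗ b`. -/
def tmul (a : A) (b : B) : CStarTensor A B :=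
  ⟨preTmul a b, subset_closedIdeal _ _ ⟨a, b, rfl⟩⟩

end Tensor

/-! ### The compact operators -/

/-- The Hilbert space `ℓ²(ℕ)`. -/
abbrev Ell2 : Type := lp (fun _ : ℕ => ℂ) 2

/-- The standard basis vector `e_i`. -/
def basisVec (i : ℕ) : Ell2 := lp.single 2 i (1 : ℂ)

theorem isCompactOperator_adjoint {T : Ell2 →L[ℂ] Ell2} (hT : IsCompactOperator T) :
    IsCompactOperator (star T : Ell2 →L[ℂ] Ell2) := by
  have hS : IsCompactOperator (T * star T : Ell2 →L[ℂ] Ell2) := hT.comp_clm (star T)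
  have hS' := (hS.isCompact_closure_image_closedBall 1).totallyBounded.subset subset_closure
  refine (isCompactOperator_iff_isCompact_closure_image_closedBall
    ((star T : Ell2 →L[ℂ] Ell2) : Ell2 →ₗ[ℂ] Ell2) one_pos).2 ?_
  refine TotallyBounded.isCompact_of_isClosed (TotallyBounded.closure ?_) isClosed_closure
  refine Metric.totallyBounded_iff.2 fun ε hε => ?_
  obtain ⟨t, hts, htf, ht⟩ := Set.exists_subset_image_finite_and.1
    (Metric.finite_approx_of_totallyBounded hS' (ε ^ 2 / 4) (by positivity))
  refine ⟨(star T : Ell2 →L[ℂ] Ell2) '' t, htf.image _, ?_⟩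
  rintro _ ⟨x, hx, rfl⟩
  obtain ⟨_, ⟨y, hy, rfl⟩, hxy⟩ := Set.mem_iUnion₂.1 (ht ⟨x, hx, rfl⟩)
  refine Set.mem_iUnion₂.2 ⟨_, ⟨y, hy, rfl⟩, ?_⟩
  have hx1 : ‖x‖ ≤ 1 := by simpa using hx
  have hy1 : ‖y‖ ≤ 1 := by simpa using hts hy
  have h2 : ‖x - y‖ ≤ 2 := (norm_sub_le x y).trans (by linarith)
  have h3 : ‖T ((star T : Ell2 →L[ℂ] Ell2) (x - y))‖ < ε ^ 2 / 4 := by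
    rw [map_sub, map_sub]
    simpa [dist_eq_norm] using hxy
  have h4 : ‖(star T : Ell2 →L[ℂ] Ell2) (x - y)‖ ^ 2 ≤
      ‖T ((star T : Ell2 →L[ℂ] Ell2) (x - y))‖ * ‖x - y‖ := by
    rw [← inner_self_eq_norm_sq (𝕜 := ℂ)]
    conv_lhs => rw [ContinuousLinearMap.star_eq_adjoint, ContinuousLinearMap.adjoint_inner_right]
    exact re_inner_le_norm _ _
  have h5 : ‖(star T : Ell2 →L[ℂ] Ell2) (x - y)‖ < ε := by
    refine lt_of_pow_lt_pow_left₀ 2 hε.le (h4.trans_lt ?_)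
    have := mul_le_mul_of_nonneg_left h2 (norm_nonneg (T ((star T : Ell2 →L[ℂ] Ell2) (x - y))))
    have h0 : 0 < ε ^ 2 := by positivity
    linarith
  rw [Metric.mem_ball, dist_eq_norm]
  rw [map_sub] at h5
  exact h5

/-- The C*-algebra `𝒦` of compact operators on `ℓ²(ℕ)`. -/
def Compacts : NonUnitalStarSubalgebra ℂ (Ell2 →L[ℂ] Ell2) where
  carrier := {T | IsCompactOperator T}
  add_mem' ha hb := IsCompactOperator.add ha hb
  zero_mem' := isCompactOperator_zero
  mul_mem' {_ b} ha _ := IsCompactOperator.comp_clm ha b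
  smul_mem' c _ ha := IsCompactOperator.smul ha c
  star_mem' ha := isCompactOperator_adjoint ha

instance : IsClosed (Compacts : Set (Ell2 →L[ℂ] Ell2)) :=
  isClosed_setOfPred_isCompactOperator

/-- The partial isometry `x_i` of `𝒦`: the rank one operator `ξ ↦ ⟨e_0, ξ⟩ e_i`, which sends `e_0`
to `e_i` and the other basis vectors to `0`. -/
def matrixCol (i : ℕ) : Compacts :=
  ⟨InnerProductSpace.rankOne ℂ (basisVec i) (basisVec 0),
    (isCompactOperator_of_locallyCompactSpace_dom
      (innerSL ℂ (basisVec 0))).clm_comp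
      (ContinuousLinearMap.toSpanSingleton ℂ (basisVec i))⟩

/-! ### The unital free product `C(S¹) *_ℂ ℂ²` -/

/-- The unital free product `C(S¹) *_ℂ ℂ²`. -/
abbrev CircleFreeC2 : Type := FreeProduct C(Circle, ℂ) (ℂ × ℂ)

/-- The unitary `ū` of `C(S¹) *_ℂ ℂ²`: the identity function `z` of `C(S¹)`. -/
def CircleFreeC2.ubar : CircleFreeC2 :=
  FreeProduct.inl (⟨fun z => (z : ℂ), continuous_subtype_val⟩ : C(Circle, ℂ))

/-- The projection `p̄` of `C(S¹) *_ℂ ℂ²`: the vector `(1, 0)` of `ℂ²`. -/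
def CircleFreeC2.pbar : CircleFreeC2 := FreeProduct.inr ((1, 0) : ℂ × ℂ)

end TwistedIsometries

end

/-! Write `λ` for `rot θ`, `D` for `C(S¹) *_ℂ ℂ²`, `w = uv` and `q = 1 - ww*`. Since `w` is an
isometry, the elements `wⁱ q` form a column of matrix units: `(wⁱq)*(wʲq)` is `q` if `i = j` and `0`
otherwise. In the corner at `q` the element `ū` is a unitary and `p̄` a projection, so the universal
property of `D` yields a homomorphism `δ = FreeTwist.corner` from `D` into that corner. Both defects
lie in its range, because `1 - uu* = ū p̄ ū*` and `1 - vv* = q - p̄`. Moreover `uq`, `vq`, `u*q`,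
`v*q` are words in `ū`, `p̄` plus at most `w` times such words, and `u`, `v` commute with `w` up to
a scalar. Hence the closed span of all `wⁱ δ(d) (wʲq)*` is an ideal, and it equals `J`
(`FreeTwist.defectIdeal_eq`). The algebra `D ⊗ 𝒦` has the same shape, with `1 ⊗ x_i` in place of `wⁱ
q` (`TensorAmbient.cStarTensor_eq`).

What remains is the injectivity of `δ`. The multiplication formulas dictate a model. Let `s` be the
shift and `l` the diagonal unitary `e_i ↦ λⁱ e_i`; then `u` should act as `ū(1-p̄) ⊗ l + ūp̄ ⊗ sl`
and `v` as `p̄ū* ⊗ l* + λ̄ (1-p̄)ū* ⊗ sl*`. These elements of `D ⊗ B(ℓ²)` satisfy the defining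
relations (`FreeTwist.exists_model`), and the resulting homomorphism sends `w` to `1 ⊗ s` and `δ(d)`
to `d ⊗ e₀₀`. The latter is nonzero for `d ≠ 0`, by a GNS representation of `D`
(`UnitalTensor.inl_mul_inr_ne_zero`). The factor `B(ℓ²)` replaces `𝒦` because `s` and `l` are not
compact.

A homomorphism that is faithful on the corner is faithful on the whole closed span, since the
entries `(wⁱq)* x (wʲq)` of an element `x` of its kernel lie in the corner and therefore vanish
(`eq_zero_of_mem_cornerSpan`). So `J` and `D ⊗ 𝒦` both embed into `D ⊗ B(ℓ²)`. Matching generators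
have the same image, so the closed ranges coincide, and identifying them gives the isomorphism
(`exists_starAlgEquiv_of_cornerSpan`). -/

noncomputable section

namespace TwistedIsometries

universe u

/-! ### The universal property of `C*(G | R)`. -/

namespace UnivCStar

variable {G : Type u} (R : Set (StarPoly G)) [BoundedRelations R]

/-- A closed property stable under the algebraic operations holds on the whole universal
C*-algebra once it holds for the generators and their adjoints. -/
theorem induction_gen {C : UnivCStar R → Prop} (hc : IsClosed {a | C a})
    (hs : ∀ r : ℂ, C (algebraMap ℂ _ r)) (hg : ∀ g, C (of R g)) (hg' : ∀ g, C (star (of R g)))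
    (hm : ∀ a b, C a → C b → C (a * b)) (ha : ∀ a b, C a → C b → C (a + b))
    (a : UnivCStar R) : C a := by
  refine induction R hc (fun p => ?_) a
  induction p using StarPoly.induction with
  | hs r =>
    rw [Algebra.algebraMap_eq_smul_one, mk_smul, mk_one, ← Algebra.algebraMap_eq_smul_one]
    exact hs r
  | hg g => exact hg g
  | hg' g => rw [mk_genStar]; exact hg' g
  | hm a b h1 h2 => rw [mk_mul]; exact hm _ _ h1 h2
  | ha a b h1 h2 => rw [mk_add]; exact ha _ _ h1 h2

/-- The representation `y` is one of those over which the universal seminorm is a supremum, so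
evaluation at `y` is contractive and extends to the completion. All algebraic identities pass to the
extension by density. -/
theorem exists_lift {B : Type u} [CStarAlgebra B] {y : G → B} (hy : IsRep R y) :
    ∃ φ : UnivCStar R →⋆ₐ[ℂ] B, ∀ g, φ (of R g) = y g := by
  let e : PreUniv R → B := fun p => StarPoly.eval y (p : StarPoly G)
  have he : LipschitzWith 1 e := LipschitzWith.of_dist_le_mul fun p q => by
    rw [NNReal.coe_one, one_mul, dist_eq_norm, dist_eq_norm]
    have : e p - e q = StarPoly.eval y (p - q : PreUniv R) :=
      (map_sub (StarPoly.eval y) (p : StarPoly G) q).symm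
    rw [this]
    exact le_univNorm R hy _
  let φ : UnivCStar R → B := UniformSpace.Completion.extension e
  have hφc : Continuous φ := UniformSpace.Completion.continuous_extension
  have hφ : ∀ p, φ (mk R p) = StarPoly.eval y p := fun p =>
    UniformSpace.Completion.extension_coe he.uniformContinuous (p : PreUniv R)
  have hadd : ∀ a b, φ (a + b) = φ a + φ b := fun a b => by
    refine induction R (C := fun a => φ (a + b) = φ a + φ b)
      (isClosed_eq (by fun_prop) (by fun_prop)) (fun p => ?_) a
    refine induction R (C := fun b => φ (mk R p + b) = φ (mk R p) + φ b)
      (isClosed_eq (by fun_prop) (by fun_prop)) (fun q => ?_) b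
    rw [← mk_add, hφ, hφ, hφ, map_add]
  have hmul : ∀ a b, φ (a * b) = φ a * φ b := fun a b => by
    refine induction R (C := fun a => φ (a * b) = φ a * φ b)
      (isClosed_eq (by fun_prop) (by fun_prop)) (fun p => ?_) a
    refine induction R (C := fun b => φ (mk R p * b) = φ (mk R p) * φ b)
      (isClosed_eq (by fun_prop) (by fun_prop)) (fun q => ?_) b
    rw [← mk_mul, hφ, hφ, hφ, map_mul]
  have halg : ∀ c, φ (algebraMap ℂ _ c) = algebraMap ℂ B c := fun c => by
    rw [Algebra.algebraMap_eq_smul_one, ← mk_one, ← mk_smul, hφ, map_smul, map_one,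
      ← Algebra.algebraMap_eq_smul_one]
  have hone : φ 1 = 1 := by rw [← mk_one, hφ, map_one]
  have hstar : ∀ a, φ (star a) = star (φ a) := fun a => by
    refine induction R (C := fun a => φ (star a) = star (φ a))
      (isClosed_eq (hφc.comp continuous_star) (by fun_prop)) (fun p => ?_) a
    rw [← mk_star, hφ, hφ, StarPoly.eval_star]
  refine ⟨{ toFun := φ, map_one' := hone, map_mul' := hmul, map_zero' := ?_, map_add' := hadd
            commutes' := halg, map_star' := hstar }, fun g => ?_⟩
  · simpa using halg 0
  · exact (hφ _).trans (StarPoly.eval_gen y g)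

/-- The *-homomorphism out of the universal C*-algebra determined by a representation. -/
def lift {B : Type u} [CStarAlgebra B] (y : G → B) (hy : IsRep R y) : UnivCStar R →⋆ₐ[ℂ] B :=
  (exists_lift R hy).choose

theorem lift_of {B : Type u} [CStarAlgebra B] (y : G → B) (hy : IsRep R y) (g : G) :
    lift R y hy (of R g) = y g :=
  (exists_lift R hy).choose_spec g

end UnivCStar

/-! ### Relations that encode a *-homomorphism. -/

section AlgebraRels

variable {A G : Type u} [NonUnitalCStarAlgebra A]

theorem eval_eq_zero_of_mem_algebraRels {j : A → G} {B : Type u} [CStarAlgebra B] {y : G → B}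
    (φ : A →⋆ₙₐ[ℂ] B) (hφ : ∀ a, y (j a) = φ a) {r : StarPoly G} (hr : r ∈ algebraRels j) :
    StarPoly.eval y r = 0 := by
  rcases hr with ((⟨a, b, rfl⟩ | ⟨c, a, rfl⟩) | ⟨a, b, rfl⟩) | ⟨a, rfl⟩ <;>
    simp [hφ, map_star]

/-- The canonical *-homomorphism from `A` into a universal C*-algebra whose relations contain
those of `A`. -/
def ofAlgebraRels {R : Set (StarPoly G)} [BoundedRelations R] {j : A → G}
    (hR : algebraRels j ⊆ R) : A →⋆ₙₐ[ℂ] UnivCStar R where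
  toFun a := UnivCStar.of R (j a)
  map_add' a b := by
    have := UnivCStar.mk_eq_zero R (hR (.inl (.inl (.inl ⟨a, b, rfl⟩))))
    rwa [UnivCStar.mk_sub, UnivCStar.mk_add, sub_eq_zero] at this
  map_smul' c a := by
    have := UnivCStar.mk_eq_zero R (hR (.inl (.inl (.inr ⟨c, a, rfl⟩))))
    rwa [UnivCStar.mk_sub, UnivCStar.mk_smul, sub_eq_zero] at this
  map_mul' a b := by
    have := UnivCStar.mk_eq_zero R (hR (.inl (.inr ⟨a, b, rfl⟩)))
    rwa [UnivCStar.mk_sub, UnivCStar.mk_mul, sub_eq_zero] at this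
  map_star' a := by
    have := UnivCStar.mk_eq_zero R (hR (.inr ⟨a, rfl⟩))
    rwa [UnivCStar.mk_sub, UnivCStar.mk_star, sub_eq_zero] at this
  map_zero' := by
    have := UnivCStar.mk_eq_zero R (hR (.inl (.inl (.inr ⟨0, 0, rfl⟩))))
    rwa [UnivCStar.mk_sub, UnivCStar.mk_smul, sub_eq_zero, zero_smul, zero_smul] at this

/-- A non-unital *-homomorphism preserving the unit is a unital *-homomorphism. -/
def starAlgHomOfMapOne {A B : Type*} [CStarAlgebra A] [CStarAlgebra B] (φ : A →⋆ₙₐ[ℂ] B)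
    (h : φ 1 = 1) : A →⋆ₐ[ℂ] B :=
  { φ with
    map_one' := h
    commutes' := fun c => by
      have := map_smul φ c 1
      rw [h, ← Algebra.algebraMap_eq_smul_one, ← Algebra.algebraMap_eq_smul_one] at this
      exact this }

end AlgebraRels

/-! ### States and the Hilbert space tensor product -/

section State

open scoped ComplexOrder CStarAlgebra

variable {A : Type*} [CStarAlgebra A]

/-- A nonzero positive element of a C*-algebra is detected by a positive functional. -/
theorem exists_positive_functional_ne_zero [PartialOrder A] [StarOrderedRing A] {a : A}
    (ha : 0 ≤ a) (h0 : a ≠ 0) : ∃ f : A →ₚ[ℂ] ℂ, f a ≠ 0 := by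
  let C : ProperCone ℝ A :=
    { carrier := {x | 0 ≤ x}
      add_mem' := fun ha hb => add_nonneg ha hb
      zero_mem' := le_rfl
      smul_mem' := fun c x hx => smul_nonneg c.2 hx
      isClosed' := CStarAlgebra.isClosed_nonneg }
  have hC : ∀ x : A, x ∈ C ↔ 0 ≤ x := fun x => Iff.rfl
  -- Were `-a` positive as well, `a` would vanish. Separating `-a` from the closed positive cone
  -- gives a real functional `g`, nonnegative on the cone and negative at `-a`.
  have hna : -a ∉ C := fun h => h0 (le_antisymm (neg_nonneg.1 ((hC _).1 h)) ha)
  obtain ⟨g, hg, hg0⟩ := C.hyperplane_separation_point hna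
  -- The complex-linear extension of the restriction of `g` to the self-adjoint part.
  let f : A →ₗ[ℂ] ℂ :=
    { toFun := fun x => (g (realPart x : A) : ℂ) + Complex.I * (g (imaginaryPart x : A) : ℂ)
      map_add' := fun x y => by simp; ring
      map_smul' := fun c x => by
        simp [realPart_smul, imaginaryPart_smul]
        apply Complex.ext <;> simp }
  have hf : ∀ x : A, 0 ≤ x → f x = (g x : ℂ) := fun x hx => by
    have hx' := IsSelfAdjoint.of_nonneg hx
    simp [f, hx'.coe_realPart, hx'.imaginaryPart]
  refine ⟨PositiveLinearMap.mk₀ f fun x hx => ?_, ?_⟩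
  · rw [hf x hx]
    exact_mod_cast hg x hx
  · change f a ≠ 0
    rw [hf a ha]
    have : g a ≠ 0 := fun h => by simp [h] at hg0
    exact_mod_cast this

/-- GNS for a positive functional `f` with `f (a* a) ≠ 0`: the class of `1` is moved by `a` to a
vector of squared norm `f (a* a)`. -/
theorem exists_hilbert_rep_ne_zero {A : Type u} [CStarAlgebra A] {a : A} (ha : a ≠ 0) :
    ∃ (H : Type u) (_ : NormedAddCommGroup H) (_ : InnerProductSpace ℂ H) (_ : CompleteSpace H)
      (π : A →⋆ₐ[ℂ] (H →L[ℂ] H)), π a ≠ 0 := by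
  let _ := CStarAlgebra.spectralOrder A
  have := CStarAlgebra.spectralOrderedRing A
  obtain ⟨f, hf⟩ := exists_positive_functional_ne_zero (star_mul_self_nonneg a)
    (fun h => ha ((CStarRing.star_mul_self_eq_zero_iff a).1 h))
  refine ⟨f.GNS, inferInstance, inferInstance, inferInstance, f.gnsStarAlgHom, fun h => hf ?_⟩
  have h0 : f.gnsNonUnitalStarAlgHom a = 0 := h
  have h1 : f.gnsNonUnitalStarAlgHom a (f.toPreGNS 1 : f.PreGNS) = 0 := by rw [h0]; rfl
  rw [PositiveLinearMap.gnsNonUnitalStarAlgHom_apply_coe] at h1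
  have h2 := congrArg norm h1
  rw [UniformSpace.Completion.norm_coe, norm_zero] at h2
  have h3 := f.preGNS_norm_sq (f.leftMulMapPreGNS a (f.toPreGNS 1))
  rw [h2] at h3
  simpa using h3.symm

end State

end TwistedIsometries
end

noncomputable section

namespace TwistedIsometries

universe u

/-! ### Ampliations to the Hilbert space tensor product. -/

section HilbertTensor

open scoped TensorProduct InnerProductSpace
open UniformSpace

variable (H K : Type*) [NormedAddCommGroup H] [InnerProductSpace ℂ H]
  [NormedAddCommGroup K] [InnerProductSpace ℂ K]

/-- The Hilbert space tensor product. -/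
abbrev HilbertTensor : Type _ := Completion (H ⊗[ℂ] K)

variable {H K}

theorem inner_rTensor_star [CompleteSpace H] (T : H →L[ℂ] H) (x y : H ⊗[ℂ] K) :
    ⟪(star T).rTensor K x, y⟫_ℂ = ⟪x, T.rTensor K y⟫_ℂ := by
  induction x using TensorProduct.induction_on with
  | zero => simp
  | add a b h1 h2 => rw [map_add, inner_add_left, inner_add_left, h1, h2]
  | tmul a b =>
    induction y using TensorProduct.induction_on with
    | zero => simp
    | add c d h1 h2 => rw [map_add, inner_add_right, inner_add_right, h1, h2]
    | tmul c d =>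
      simp [ContinuousLinearMap.star_eq_adjoint, ContinuousLinearMap.adjoint_inner_left]

theorem inner_lTensor_star [CompleteSpace K] (T : K →L[ℂ] K) (x y : H ⊗[ℂ] K) :
    ⟪(star T).lTensor H x, y⟫_ℂ = ⟪x, T.lTensor H y⟫_ℂ := by
  induction x using TensorProduct.induction_on with
  | zero => simp
  | add a b h1 h2 => rw [map_add, inner_add_left, inner_add_left, h1, h2]
  | tmul a b =>
    induction y using TensorProduct.induction_on with
    | zero => simp
    | add c d h1 h2 => rw [map_add, inner_add_right, inner_add_right, h1, h2]
    | tmul c d =>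
      simp [ContinuousLinearMap.star_eq_adjoint, ContinuousLinearMap.adjoint_inner_left]

/-- A bounded operator on a completion is determined by its values on the dense subspace. -/
theorem completion_clm_ext {E F : Type*} [NormedAddCommGroup E] [NormedSpace ℂ E]
    [NormedAddCommGroup F] [NormedSpace ℂ F] {S T : Completion E →L[ℂ] F}
    (h : ∀ x : E, S x = T x) : S = T := by
  ext x
  induction x using Completion.induction_on with
  | hp => exact isClosed_eq S.continuous T.continuous
  | ih x => exact h x

theorem completion_clm_star {E : Type*} [NormedAddCommGroup E] [InnerProductSpace ℂ E]
    {S T : E →L[ℂ] E} (h : ∀ x y, ⟪S x, y⟫_ℂ = ⟪x, T y⟫_ℂ) :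
    S.completion = star T.completion := by
  refine (ContinuousLinearMap.eq_adjoint_iff _ _).2 fun x y => ?_
  induction x, y using Completion.induction_on₂ with
  | hp => apply isClosed_eq <;> fun_prop
  | ih x y => simp [h]

variable (H K) [CompleteSpace H] [CompleteSpace K]

/-- The representation `T ↦ T ⊗ 1` on the Hilbert space tensor product. -/
def ampLeft : (H →L[ℂ] H) →⋆ₐ[ℂ] (HilbertTensor H K →L[ℂ] HilbertTensor H K) where
  toFun T := (T.rTensor K).completion
  map_one' := completion_clm_ext fun x => by simp
  map_mul' S T := completion_clm_ext fun x => by simp [ContinuousLinearMap.rTensor_mul]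
  map_zero' := completion_clm_ext fun x => by simp
  map_add' S T := completion_clm_ext fun x => by simp [Completion.coe_add]
  commutes' c := completion_clm_ext fun x => by
    simp [Algebra.algebraMap_eq_smul_one]
  map_star' T := completion_clm_star (inner_rTensor_star T)

/-- The representation `T ↦ 1 ⊗ T` on the Hilbert space tensor product. -/
def ampRight : (K →L[ℂ] K) →⋆ₐ[ℂ] (HilbertTensor H K →L[ℂ] HilbertTensor H K) where
  toFun T := (T.lTensor H).completion
  map_one' := completion_clm_ext fun x => by
    rw [ContinuousLinearMap.completion_apply_coe, ContinuousLinearMap.lTensor_one]; rfl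
  map_mul' S T := completion_clm_ext fun x => by
    rw [ContinuousLinearMap.lTensor_mul]
    simp only [mul_apply_eq_comp, ContinuousLinearMap.completion_apply_coe]
  map_zero' := completion_clm_ext fun x => by
    rw [ContinuousLinearMap.completion_apply_coe, ContinuousLinearMap.lTensor_zero]; rfl
  map_add' S T := completion_clm_ext fun x => by
    rw [ContinuousLinearMap.lTensor_add]
    simp [-ContinuousLinearMap.lTensor_apply, -ContinuousLinearMap.toLinearMap_lTensor,
      Completion.coe_add]
  commutes' c := completion_clm_ext fun x => by
    rw [Algebra.algebraMap_eq_smul_one, ContinuousLinearMap.lTensor_smul,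
      ContinuousLinearMap.lTensor_one]
    simp [Algebra.algebraMap_eq_smul_one]
  map_star' T := completion_clm_star (inner_lTensor_star T)

variable {H K}

theorem ampLeft_apply_coe (T : H →L[ℂ] H) (x : H ⊗[ℂ] K) :
    ampLeft H K T x = (T.rTensor K x : H ⊗[ℂ] K) :=
  ContinuousLinearMap.completion_apply_coe _ _

theorem ampRight_apply_coe (T : K →L[ℂ] K) (x : H ⊗[ℂ] K) :
    ampRight H K T x = (T.lTensor H x : H ⊗[ℂ] K) :=
  ContinuousLinearMap.completion_apply_coe _ _

theorem ampLeft_mul_ampRight_apply (S : H →L[ℂ] H) (T : K →L[ℂ] K) (x : H) (y : K) :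
    (ampLeft H K S * ampRight H K T) ((x ⊗ₜ[ℂ] y : H ⊗[ℂ] K) : HilbertTensor H K) =
      ((S x ⊗ₜ[ℂ] T y : H ⊗[ℂ] K) : HilbertTensor H K) := by
  rw [mul_apply_eq_comp, ampRight_apply_coe, ContinuousLinearMap.lTensor_tmul,
    ampLeft_apply_coe, ContinuousLinearMap.rTensor_tmul]

theorem ampLeft_commute_ampRight (S : H →L[ℂ] H) (T : K →L[ℂ] K) :
    Commute (ampLeft H K S) (ampRight H K T) := by
  refine completion_clm_ext fun x => ?_
  induction x using TensorProduct.induction_on with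
  | zero => rw [Completion.coe_zero, map_zero, map_zero]
  | add a b h1 h2 => rw [Completion.coe_add, map_add, map_add, h1, h2]
  | tmul a b =>
    rw [ampLeft_mul_ampRight_apply, mul_apply_eq_comp, ampLeft_apply_coe,
      ContinuousLinearMap.rTensor_tmul, ampRight_apply_coe, ContinuousLinearMap.lTensor_tmul]

/-- The Hilbert space norm is a cross norm, so `S x ⊗ T y` has norm `‖S x‖ ‖T y‖`, which is nonzero
for suitable `x` and `y`. -/
theorem ampLeft_mul_ampRight_ne_zero {S : H →L[ℂ] H} {T : K →L[ℂ] K} (hS : S ≠ 0) (hT : T ≠ 0) :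
    ampLeft H K S * ampRight H K T ≠ 0 := by
  obtain ⟨x, hx⟩ := DFunLike.ne_iff.1 hS
  obtain ⟨y, hy⟩ := DFunLike.ne_iff.1 hT
  intro h
  have h1 := ampLeft_mul_ampRight_apply S T x y
  rw [h] at h1
  have h2 := congrArg norm h1
  rw [Completion.norm_coe, TensorProduct.norm_tmul, zero_apply, norm_zero] at h2
  exact mul_ne_zero (norm_ne_zero_iff.2 hx) (norm_ne_zero_iff.2 hy) h2.symm

end HilbertTensor

/-! ### The maximal tensor product of unital C*-algebras. -/

section UnitalTensor

variable (A B : Type u) [CStarAlgebra A] [CStarAlgebra B]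

/-- The relations of the maximal tensor product of two unital C*-algebras. -/
def unitalTensorRels : Set (StarPoly (A ⊕ B)) := tensorRels A B ∪ {.gen (Sum.inr 1) - 1}

instance : BoundedRelations (unitalTensorRels A B) where
  bound g := by
    obtain ⟨C, hC⟩ := BoundedRelations.bound (R := tensorRels A B) g
    exact ⟨C, fun D _ y hy => hC D y fun r hr => hy r (.inl hr)⟩

/-- The maximal tensor product of two unital C*-algebras. -/
abbrev UnitalTensor : Type u := UnivCStar (unitalTensorRels A B)

namespace UnitalTensor

/-- The canonical unital *-homomorphism `a ↦ a ⊗ 1`. -/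
def inl : A →⋆ₐ[ℂ] UnitalTensor A B :=
  starAlgHomOfMapOne
    (ofAlgebraRels (R := unitalTensorRels A B) (j := Sum.inl) fun _ h => .inl (.inl (.inl (.inl h))))
    (by
      have := UnivCStar.mk_eq_zero (unitalTensorRels A B)
        (r := .gen (Sum.inl 1) - 1) (.inl (.inl (.inr rfl)))
      rwa [UnivCStar.mk_sub, sub_eq_zero, UnivCStar.mk_one] at this)

/-- The canonical unital *-homomorphism `b ↦ 1 ⊗ b`. -/
def inr : B →⋆ₐ[ℂ] UnitalTensor A B :=
  starAlgHomOfMapOne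
    (ofAlgebraRels (R := unitalTensorRels A B) (j := Sum.inr) fun _ h => .inl (.inl (.inl (.inr h))))
    (by
      have := UnivCStar.mk_eq_zero (unitalTensorRels A B) (r := .gen (Sum.inr 1) - 1) (.inr rfl)
      rwa [UnivCStar.mk_sub, sub_eq_zero, UnivCStar.mk_one] at this)

variable {A B}

theorem commute_inl_inr (a : A) (b : B) : Commute (inl A B a) (inr A B b) := by
  have := UnivCStar.mk_eq_zero (unitalTensorRels A B) (.inl (.inr ⟨a, b, rfl⟩))
  rwa [UnivCStar.mk_sub, UnivCStar.mk_mul, UnivCStar.mk_mul, sub_eq_zero] at this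

/-- A representation `π` with `π a ≠ 0`, amplified to `H ⊗ K`, sends `a ⊗ T` to the nonzero operator
`π a ⊗ T`. Nothing is needed about faithfulness on general tensors. -/
theorem inl_mul_inr_ne_zero {K : Type u} [NormedAddCommGroup K] [InnerProductSpace ℂ K]
    [CompleteSpace K] {a : A} (ha : a ≠ 0) {T : K →L[ℂ] K} (hT : T ≠ 0) :
    inl A (K →L[ℂ] K) a * inr A (K →L[ℂ] K) T ≠ 0 := by
  obtain ⟨H, _, _, _, π, hπ⟩ := exists_hilbert_rep_ne_zero ha
  have hy : IsRep (unitalTensorRels A (K →L[ℂ] K))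
      (Sum.elim (fun a => ampLeft H K (π a)) (fun b => ampRight H K b)) := by
    rintro r ((((hr | hr) | hr) | ⟨a, b, rfl⟩) | hr)
    · exact eval_eq_zero_of_mem_algebraRels (j := Sum.inl)
        (((ampLeft H K).comp π : A →⋆ₐ[ℂ] _) : A →⋆ₙₐ[ℂ] _) (fun a => rfl) hr
    · exact eval_eq_zero_of_mem_algebraRels (j := Sum.inr)
        ((ampRight H K : _ →⋆ₐ[ℂ] _) : (K →L[ℂ] K) →⋆ₙₐ[ℂ] _) (fun a => rfl) hr
    · rw [Set.mem_singleton_iff.1 hr]; simp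
    · simp [(ampLeft_commute_ampRight (π a) b).eq]
    · rw [Set.mem_singleton_iff.1 hr]; simp
  intro h
  have h1 := congrArg (UnivCStar.lift _ _ hy) h
  rw [map_mul, map_zero] at h1
  refine ampLeft_mul_ampRight_ne_zero hπ hT (Eq.trans ?_ h1)
  exact congrArg₂ (· * ·) (UnivCStar.lift_of _ _ hy (Sum.inl a)).symm
    (UnivCStar.lift_of _ _ hy (Sum.inr T)).symm

end UnitalTensor

end UnitalTensor

end TwistedIsometries
end

noncomputable section

namespace TwistedIsometries

universe u

/-! ### Closed spans of matrix type over a corner. -/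

section Corner

open scoped CStarAlgebra

variable {A D N : Type*} [CStarAlgebra A] [CStarAlgebra D] [CStarAlgebra N]

/-- The closed linear span of the elements `w i * δ d * (w j)*`. -/
def cornerSpan (δ : D →⋆ₙₐ[ℂ] A) (w : ℕ → A) : Submodule ℂ A :=
  (Submodule.span ℂ {x | ∃ i j d, x = w i * δ d * star (w j)}).topologicalClosure

variable {δ : D →⋆ₙₐ[ℂ] A} {w : ℕ → A}

theorem mem_cornerSpan (i j : ℕ) (d : D) : w i * δ d * star (w j) ∈ cornerSpan δ w :=
  Submodule.le_topologicalClosure _ (Submodule.subset_span ⟨i, j, d, rfl⟩)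

theorem isClosed_cornerSpan : IsClosed (cornerSpan δ w : Set A) :=
  Submodule.isClosed_topologicalClosure _

theorem cornerSpan_induction {C : A → Prop} (hc : IsClosed {a | C a})
    (hg : ∀ i j d, C (w i * δ d * star (w j))) (h0 : C 0) (ha : ∀ a b, C a → C b → C (a + b))
    (hs : ∀ (c : ℂ) a, C a → C (c • a)) {a : A} (h : a ∈ cornerSpan δ w) : C a := by
  refine closure_minimal (fun x hx => ?_) hc h
  refine Submodule.span_induction (p := fun x _ => C x) ?_ h0 (fun _ _ _ _ => ha _ _)
    (fun c _ _ => hs c _) hx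
  rintro _ ⟨i, j, d, rfl⟩
  exact hg i j d

theorem star_mem_cornerSpan {a : A} (h : a ∈ cornerSpan δ w) : star a ∈ cornerSpan δ w := by
  refine cornerSpan_induction (C := fun a => star a ∈ cornerSpan δ w)
    (isClosed_cornerSpan.preimage continuous_star) (fun i j d => ?_) ?_ (fun a b h1 h2 => ?_)
    (fun c a h => ?_) h
  · have := mem_cornerSpan (δ := δ) (w := w) j i (star d)
    simpa [mul_assoc, map_star] using this
  · simp
  · rw [star_add]; exact add_mem h1 h2
  · rw [star_smul]; exact Submodule.smul_mem _ _ h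

/-- A *-homomorphism is injective on the closed span of `w i * δ d * (w j)*` as soon as it is
injective on the corner `δ D`. -/
theorem eq_zero_of_mem_cornerSpan
    (hw : ∀ i j, star (w i) * w j = if i = j then δ 1 else 0) (φ : A →⋆ₐ[ℂ] N)
    (hφ : ∀ d, φ (δ d) = 0 → d = 0) {x : A} (hx : x ∈ cornerSpan δ w) (h0 : φ x = 0) : x = 0 := by
  have hinj : Function.Injective δ := (injective_iff_map_eq_zero δ).2 fun d hd =>
    hφ d (by rw [hd, map_zero])
  -- An injective *-homomorphism of C*-algebras is isometric, so its range is complete. This lets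
  -- the next claim pass to the closed span.
  have hcl : IsClosed (Set.range δ) := 
    (NonUnitalStarAlgHom.isometry δ hinj).isClosedEmbedding.isClosed_range
  -- The matrix entries of `x`: on a generator, orthogonality leaves either `δ d` or `0`.
  have hcorner : ∀ i j, star (w i) * x * w j ∈ Set.range δ := fun i j => by
    refine cornerSpan_induction (C := fun x => star (w i) * x * w j ∈ Set.range δ)
      (hcl.preimage (by fun_prop)) (fun k l d => ?_) ?_ (fun a b h1 h2 => ?_)
      (fun c a h => ?_) hx
    · have : star (w i) * (w k * δ d * star (w l)) * w j =
          (star (w i) * w k) * δ d * (star (w l) * w j) := by simp only [mul_assoc]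
      rw [this, hw, hw]
      split_ifs
      · exact ⟨1 * d * 1, by rw [map_mul, map_mul]⟩
      all_goals exact ⟨0, by simp⟩
    · exact ⟨0, by simp⟩
    · obtain ⟨a', ha'⟩ := h1
      obtain ⟨b', hb'⟩ := h2
      exact ⟨a' + b', by rw [map_add, ha', hb', mul_add, add_mul]⟩
    · obtain ⟨a', ha'⟩ := h
      exact ⟨c • a', by rw [map_smul, ha', mul_smul_comm, smul_mul_assoc]⟩
  have hzero : ∀ i j, star (w i) * x * w j = 0 := fun i j => by
    obtain ⟨d, hd⟩ := hcorner i j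
    have : φ (δ d) = 0 := by rw [hd, map_mul, map_mul, h0, mul_zero, zero_mul]
    rw [← hd, hφ d this, map_zero]
  -- Vanishing of all entries makes `x` annihilated between any two elements of the span, one side
  -- at a time; no approximate unit is required.
  have h1 : ∀ y ∈ cornerSpan δ w, ∀ j, y * x * w j = 0 := fun y hy j => by
    refine cornerSpan_induction (C := fun y => y * x * w j = 0)
      (isClosed_eq (by fun_prop) (by fun_prop)) (fun k l d => ?_) ?_ (fun a b h1 h2 => ?_)
      (fun c a h => ?_) hy
    · have : w k * δ d * star (w l) * x * w j = w k * δ d * (star (w l) * x * w j) := by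
        simp only [mul_assoc]
      rw [this, hzero, mul_zero]
    · simp
    · rw [add_mul, add_mul, h1, h2, add_zero]
    · rw [smul_mul_assoc, smul_mul_assoc, h, smul_zero]
  have h2 : ∀ y ∈ cornerSpan δ w, ∀ z ∈ cornerSpan δ w, y * x * z = 0 := fun y hy z hz => by
    refine cornerSpan_induction (C := fun z => y * x * z = 0)
      (isClosed_eq (by fun_prop) (by fun_prop)) (fun k l d => ?_) ?_ (fun a b h1 h2 => ?_)
      (fun c a h => ?_) hz
    · have : y * x * (w k * δ d * star (w l)) = (y * x * w k) * (δ d * star (w l)) := by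
        simp only [mul_assoc]
      rw [this, h1 y hy, zero_mul]
    · simp
    · rw [mul_add, h1, h2, add_zero]
    · rw [mul_smul_comm, h, smul_zero]
  -- With `x*` on both sides this reads `x* x x* = 0`, so `(x* x)² = 0` and the C*-identity, used
  -- twice, gives `x = 0`.
  have h3 := h2 _ (star_mem_cornerSpan hx) _ (star_mem_cornerSpan hx)
  have h4 : star (star x * x) * (star x * x) = 0 := by
    rw [star_mul, star_star, ← mul_assoc, h3, zero_mul]
  exact (CStarRing.star_mul_self_eq_zero_iff x).1 ((CStarRing.star_mul_self_eq_zero_iff _).1 h4)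

end Corner

/-! ### Isomorphism by comparison of ranges. -/

section Range

open scoped CStarAlgebra

variable {A₁ A₂ N : Type*} [CStarAlgebra A₁] [CStarAlgebra A₂] [CStarAlgebra N]

/-- Two C*-subalgebras embedded with the same range in a third C*-algebra are isomorphic. -/
theorem exists_starAlgEquiv_of_range_eq {J₁ : NonUnitalStarSubalgebra ℂ A₁}
    {J₂ : NonUnitalStarSubalgebra ℂ A₂} (φ₁ : A₁ →⋆ₐ[ℂ] N) (φ₂ : A₂ →⋆ₐ[ℂ] N)
    (h₁ : ∀ x ∈ J₁, φ₁ x = 0 → x = 0) (h₂ : ∀ x ∈ J₂, φ₂ x = 0 → x = 0)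
    (hr : φ₁ '' (J₁ : Set A₁) = φ₂ '' (J₂ : Set A₂)) :
    ∃ Φ : J₁ ≃⋆ₐ[ℂ] J₂, ∀ x ∈ J₁, ∀ y : J₂, φ₂ y = φ₁ x → (Φ.symm y : A₁) = x := by
  have inj₁ : ∀ x y : J₁, φ₁ x = φ₁ y → x = y := fun x y h => by
    refine Subtype.ext (sub_eq_zero.1 (h₁ _ (sub_mem x.2 y.2) ?_))
    rw [map_sub, h, sub_self]
  have inj₂ : ∀ x y : J₂, φ₂ x = φ₂ y → x = y := fun x y h => by
    refine Subtype.ext (sub_eq_zero.1 (h₂ _ (sub_mem x.2 y.2) ?_))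
    rw [map_sub, h, sub_self]
  have ex₁ : ∀ x : J₁, ∃ y : J₂, φ₂ y = φ₁ x := fun x => by
    obtain ⟨y, hy, hxy⟩ := hr.subset ⟨x, x.2, rfl⟩
    exact ⟨⟨y, hy⟩, hxy⟩
  have ex₂ : ∀ y : J₂, ∃ x : J₁, φ₁ x = φ₂ y := fun y => by
    obtain ⟨x, hx, hxy⟩ := hr.symm.subset ⟨y, y.2, rfl⟩
    exact ⟨⟨x, hx⟩, hxy⟩
  choose f hf using ex₁
  choose g hg using ex₂
  let Φ : J₁ ≃⋆ₐ[ℂ] J₂ :=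
    { toFun := f, invFun := g
      left_inv := fun x => inj₁ _ _ (by rw [hg, hf])
      right_inv := fun y => inj₂ _ _ (by rw [hf, hg])
      map_mul' := fun x y => inj₂ _ _ (by simp [hf])
      map_add' := fun x y => inj₂ _ _ (by simp [hf])
      map_star' := fun x => inj₂ _ _ (by simp [hf, map_star])
      map_smul' := fun c x => inj₂ _ _ (by simp [hf]) }
  have hΦ : ∀ y, Φ.symm y = g y := fun _ => rfl
  refine ⟨Φ, fun x hx y h => ?_⟩
  rw [hΦ]
  exact congrArg Subtype.val (inj₁ (g y) ⟨x, hx⟩ ((hg y).trans h))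

variable {D : Type*} [CStarAlgebra D]

/-- Being injective on the closed subalgebra `J₂`, the map `φ₂` is isometric there and has closed
image. The inclusion can therefore be tested on the generators of the first span. -/
theorem image_cornerSpan_subset {δ₁ : D →⋆ₙₐ[ℂ] A₁} {w₁ : ℕ → A₁} {δ₂ : D →⋆ₙₐ[ℂ] A₂} {w₂ : ℕ → A₂}
    {J₂ : NonUnitalStarSubalgebra ℂ A₂} (hJ₂ : (J₂ : Set A₂) = cornerSpan δ₂ w₂)
    (φ₁ : A₁ →⋆ₐ[ℂ] N) (φ₂ : A₂ →⋆ₐ[ℂ] N) (h₂ : ∀ x ∈ J₂, φ₂ x = 0 → x = 0)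
    (hg : ∀ i j d, φ₁ (w₁ i * δ₁ d * star (w₁ j)) = φ₂ (w₂ i * δ₂ d * star (w₂ j))) :
    φ₁ '' (cornerSpan δ₁ w₁ : Set A₁) ⊆ φ₂ '' (J₂ : Set A₂) := by
  have hcJ : IsClosed (J₂ : Set A₂) := hJ₂ ▸ isClosed_cornerSpan
  have hcl : IsClosed (φ₂ '' (J₂ : Set A₂)) := by
    let ψ : J₂ →⋆ₙₐ[ℂ] N :=
      (φ₂ : A₂ →⋆ₙₐ[ℂ] N).comp (NonUnitalStarSubalgebraClass.subtype J₂)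
    have hψ : Function.Injective ψ := (injective_iff_map_eq_zero ψ).2 fun x hx =>
      Subtype.ext (h₂ x x.2 hx)
    have h := (NonUnitalStarAlgHom.isometry ψ hψ).isClosedEmbedding.isClosed_range
    convert h using 1
    ext y
    constructor
    · rintro ⟨x, hx, rfl⟩
      exact ⟨⟨x, hx⟩, rfl⟩
    · rintro ⟨x, rfl⟩
      exact ⟨x, x.2, rfl⟩
  rintro _ ⟨x, hx, rfl⟩
  have hmem : ∀ y, y ∈ φ₂ '' (J₂ : Set A₂) ↔ ∃ x ∈ J₂, φ₂ x = y := fun y => Iff.rfl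
  refine cornerSpan_induction (C := fun x => φ₁ x ∈ φ₂ '' (J₂ : Set A₂))
    (hcl.preimage (map_continuous φ₁)) (fun k l d => ?_) ?_ (fun a b h1 h2 => ?_)
    (fun c a h => ?_) hx
  · exact ⟨_, hJ₂ ▸ mem_cornerSpan k l d, (hg k l d).symm⟩
  · exact ⟨0, zero_mem J₂, by simp⟩
  · obtain ⟨a', ha, ha'⟩ := h1
    obtain ⟨b', hb, hb'⟩ := h2
    exact ⟨a' + b', add_mem (s := J₂) ha hb, by rw [map_add, ha', hb', map_add]⟩
  · obtain ⟨a', ha, ha'⟩ := h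
    exact ⟨c • a', SMulMemClass.smul_mem (s := J₂) c ha, by rw [map_smul, ha', map_smul]⟩

/-- Two closed spans of the form `w i * δ d * (w j)*` over the same corner are isomorphic as soon
as they can be compared in a third C*-algebra, faithfully on the corners. -/
theorem exists_starAlgEquiv_of_cornerSpan {δ₁ : D →⋆ₙₐ[ℂ] A₁} {w₁ : ℕ → A₁} {δ₂ : D →⋆ₙₐ[ℂ] A₂}
    {w₂ : ℕ → A₂} {J₁ : NonUnitalStarSubalgebra ℂ A₁} {J₂ : NonUnitalStarSubalgebra ℂ A₂}
    (hJ₁ : (J₁ : Set A₁) = cornerSpan δ₁ w₁) (hJ₂ : (J₂ : Set A₂) = cornerSpan δ₂ w₂)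
    (hw₁ : ∀ i j, star (w₁ i) * w₁ j = if i = j then δ₁ 1 else 0)
    (hw₂ : ∀ i j, star (w₂ i) * w₂ j = if i = j then δ₂ 1 else 0)
    (φ₁ : A₁ →⋆ₐ[ℂ] N) (φ₂ : A₂ →⋆ₐ[ℂ] N)
    (hφ₁ : ∀ d, φ₁ (δ₁ d) = 0 → d = 0) (hφ₂ : ∀ d, φ₂ (δ₂ d) = 0 → d = 0)
    (hg : ∀ i j d, φ₁ (w₁ i * δ₁ d * star (w₁ j)) = φ₂ (w₂ i * δ₂ d * star (w₂ j))) :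
    ∃ Φ : J₁ ≃⋆ₐ[ℂ] J₂, ∀ x ∈ J₁, ∀ y : J₂, φ₂ y = φ₁ x → (Φ.symm y : A₁) = x := by
  have h₁ : ∀ x ∈ J₁, φ₁ x = 0 → x = 0 := fun x hx =>
    eq_zero_of_mem_cornerSpan hw₁ φ₁ hφ₁ (hJ₁.subset hx)
  have h₂ : ∀ x ∈ J₂, φ₂ x = 0 → x = 0 := fun x hx =>
    eq_zero_of_mem_cornerSpan hw₂ φ₂ hφ₂ (hJ₂.subset hx)
  refine exists_starAlgEquiv_of_range_eq φ₁ φ₂ h₁ h₂ (Set.Subset.antisymm ?_ ?_)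
  · rw [hJ₁]
    exact image_cornerSpan_subset hJ₂ φ₁ φ₂ h₂ hg
  · rw [hJ₂]
    exact image_cornerSpan_subset hJ₁ φ₂ φ₁ h₁ fun i j d => (hg i j d).symm

end Range

end TwistedIsometries
end

noncomputable section

namespace TwistedIsometries

universe u

/-! ### Rank one operators and matrix units in `𝒦`. -/

section Compacts

open scoped InnerProductSpace
open InnerProductSpace

theorem inner_basisVec_left (i : ℕ) (x : Ell2) : ⟪basisVec i, x⟫_ℂ = x i := by
  rw [basisVec, lp.inner_single_left]
  simp

theorem basisVec_apply (i j : ℕ) : basisVec i j = if j = i then 1 else 0 := by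
  rw [basisVec, lp.single_apply]
  rw [Pi.single_apply]

theorem orthonormal_basisVec : Orthonormal ℂ basisVec := by
  rw [orthonormal_iff_ite]
  intro i j
  rw [inner_basisVec_left, basisVec_apply]

theorem dense_span_basisVec :
    (Submodule.span ℂ (Set.range basisVec)).topologicalClosure = ⊤ := by
  let b : HilbertBasis ℕ ℂ Ell2 := HilbertBasis.ofRepr (LinearIsometryEquiv.refl ℂ Ell2)
  have h := b.dense_span
  have hb : (b : ℕ → Ell2) = basisVec := funext fun i => (b.repr_symm_single i).symm
  rw [hb] at h
  exact h

/-- The twist `σ` is there because a rank one operator is linear in its first vector and conjugate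
linear in its second; both slots are treated by this density argument. -/
theorem mem_closed_submodule_of_basisVec {F : Type*} [NormedAddCommGroup F] [NormedSpace ℂ F]
    (f : Ell2 → F) (hf : Continuous f) (hadd : ∀ x y, f (x + y) = f x + f y)
    {σ : ℂ →+* ℂ} (hsmul : ∀ (c : ℂ) x, f (c • x) = σ c • f x) (S : Submodule ℂ F)
    (hS : IsClosed (S : Set F)) (h : ∀ i, f (basisVec i) ∈ S) (x : Ell2) : f x ∈ S := by
  have hx : x ∈ (Submodule.span ℂ (Set.range basisVec)).topologicalClosure := by
    rw [dense_span_basisVec]; trivial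
  refine closure_minimal (t := f ⁻¹' (S : Set F)) (fun y hy => ?_) (hS.preimage hf) hx
  refine Submodule.span_induction (p := fun y _ => f y ∈ S) ?_ ?_ (fun a b _ _ h1 h2 => ?_)
    (fun c a _ h => ?_) hy
  · rintro _ ⟨i, rfl⟩
    exact h i
  · have := hsmul 0 0
    rw [zero_smul, map_zero, zero_smul] at this
    rw [this]
    exact zero_mem S
  · rw [hadd]
    exact add_mem h1 h2
  · rw [hsmul]
    exact S.smul_mem _ h

theorem clm_ext_basisVec {F : Type*} [NormedAddCommGroup F] [NormedSpace ℂ F]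
    {S T : Ell2 →L[ℂ] F} (h : ∀ i, S (basisVec i) = T (basisVec i)) : S = T := by
  ext1 x
  have := mem_closed_submodule_of_basisVec (S - T) (S - T).continuous (map_add _)
    (σ := RingHom.id ℂ) (map_smul _) ⊥ isClosed_singleton (fun i => by simp [h]) x
  simpa [sub_eq_zero] using this

/-- Rank one operators as elements of `𝒦`. -/
def compactRankOne (x y : Ell2) : Compacts :=
  ⟨rankOne ℂ x y,
    (isCompactOperator_of_locallyCompactSpace_dom
      (innerSL ℂ y)).clm_comp
      (ContinuousLinearMap.toSpanSingleton ℂ x)⟩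

theorem coe_matrixCol (i : ℕ) :
    (matrixCol i : Ell2 →L[ℂ] Ell2) = rankOne ℂ (basisVec i) (basisVec 0) := rfl

theorem star_rankOne (x y : Ell2) : star (rankOne ℂ x y) = rankOne ℂ y x := by
  rw [ContinuousLinearMap.star_eq_adjoint, adjoint_rankOne]

theorem rankOne_mul_rankOne (x y z w : Ell2) :
    (rankOne ℂ x y * rankOne ℂ z w : Ell2 →L[ℂ] Ell2) = ⟪y, z⟫_ℂ • rankOne ℂ x w :=
  rankOne_comp_rankOne x y z w

theorem mul_rankOne (T : Ell2 →L[ℂ] Ell2) (x y : Ell2) :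
    T * rankOne ℂ x y = rankOne ℂ (T x) y := comp_rankOne x y T

theorem matrixCol_mul_star_matrixCol (i j : ℕ) :
    matrixCol i * star (matrixCol j) = compactRankOne (basisVec i) (basisVec j) := by
  refine Subtype.ext ?_
  change rankOne ℂ (basisVec i) (basisVec 0) * star (rankOne ℂ (basisVec j) (basisVec 0)) =
    rankOne ℂ (basisVec i) (basisVec j)
  rw [star_rankOne, rankOne_mul_rankOne, inner_basisVec_left, basisVec_apply, if_pos rfl, one_smul]

theorem star_matrixCol_mul_matrixCol (i j : ℕ) :
    star (matrixCol i) * matrixCol j = if i = j then matrixCol 0 else 0 := by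
  refine Subtype.ext ?_
  change star (rankOne ℂ (basisVec i) (basisVec 0)) * rankOne ℂ (basisVec j) (basisVec 0) = _
  rw [star_rankOne, rankOne_mul_rankOne, inner_basisVec_left, basisVec_apply]
  split_ifs with h
  · rw [one_smul]; rfl
  · rw [zero_smul]; rfl

theorem matrixCol_mul_matrixCol_zero (i : ℕ) : matrixCol i * matrixCol 0 = matrixCol i := by
  refine Subtype.ext ?_
  change rankOne ℂ (basisVec i) (basisVec 0) * rankOne ℂ (basisVec 0) (basisVec 0) =
    rankOne ℂ (basisVec i) (basisVec 0)
  rw [rankOne_mul_rankOne, inner_basisVec_left, basisVec_apply, if_pos rfl, one_smul]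

theorem star_matrixCol_zero : star (matrixCol 0) = matrixCol 0 :=
  Subtype.ext (star_rankOne _ _)

theorem norm_compactRankOne (x y : Ell2) : ‖compactRankOne x y‖ = ‖x‖ * ‖y‖ :=
  norm_rankOne x y

theorem compactRankOne_add_left (x x' y : Ell2) :
    compactRankOne (x + x') y = compactRankOne x y + compactRankOne x' y := by
  refine Subtype.ext ?_
  change rankOne ℂ (x + x') y = rankOne ℂ x y + rankOne ℂ x' y
  simp

theorem compactRankOne_add_right (x y y' : Ell2) :
    compactRankOne x (y + y') = compactRankOne x y + compactRankOne x y' := by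
  refine Subtype.ext ?_
  change rankOne ℂ x (y + y') = rankOne ℂ x y + rankOne ℂ x y'
  simp

theorem compactRankOne_smul_left (c : ℂ) (x y : Ell2) :
    compactRankOne (c • x) y = c • compactRankOne x y := by
  refine Subtype.ext ?_
  change rankOne ℂ (c • x) y = c • rankOne ℂ x y
  simp

theorem compactRankOne_smul_right (c : ℂ) (x y : Ell2) :
    compactRankOne x (c • y) = conj c • compactRankOne x y := by
  refine Subtype.ext ?_
  change rankOne ℂ x (c • y) = conj c • rankOne ℂ x y
  simp

theorem continuous_compactRankOne_left (y : Ell2) :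
    Continuous fun x => compactRankOne x y :=
  AddMonoidHomClass.continuous_of_bound
    (AddMonoidHom.mk' (fun x => compactRankOne x y) fun x x' => compactRankOne_add_left x x' y)
    ‖y‖ fun x => ((norm_compactRankOne x y).trans (mul_comm _ _)).le

theorem continuous_compactRankOne_right (x : Ell2) :
    Continuous fun y => compactRankOne x y :=
  AddMonoidHomClass.continuous_of_bound
    (AddMonoidHom.mk' (fun y => compactRankOne x y) (compactRankOne_add_right x))
    ‖x‖ fun y => (norm_compactRankOne x y).le

theorem compactRankOne_mem {S : Submodule ℂ Compacts} (hS : IsClosed (S : Set Compacts))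
    (h : ∀ i j, matrixCol i * star (matrixCol j) ∈ S) (x y : Ell2) : compactRankOne x y ∈ S := by
  refine mem_closed_submodule_of_basisVec (fun x => compactRankOne x y)
    (continuous_compactRankOne_left y) (fun x x' => compactRankOne_add_left x x' y)
    (σ := RingHom.id ℂ) (fun c x => compactRankOne_smul_left c x y) S hS (fun i => ?_) x
  refine mem_closed_submodule_of_basisVec (fun y => compactRankOne (basisVec i) y)
    (continuous_compactRankOne_right _) (fun y y' => compactRankOne_add_right _ y y')
    (σ := starRingEnd ℂ) (fun c y => compactRankOne_smul_right c _ y) S hS (fun j => ?_) y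
  rw [← matrixCol_mul_star_matrixCol]
  exact h i j

/-- The matrix units span a dense subspace of `𝒦`. -/
theorem compacts_mem_of_matrixCol {S : Submodule ℂ Compacts} (hS : IsClosed (S : Set Compacts))
    (h : ∀ i j, matrixCol i * star (matrixCol j) ∈ S) (k : Compacts) : k ∈ S := by
  refine hS.closure_subset (Metric.mem_closure_iff.2 fun ε hε => ?_)
  have hk : IsCompactOperator ((k : Ell2 →L[ℂ] Ell2) : Ell2 → Ell2) := k.2
  have htb := (hk.isCompact_closure_image_closedBall 1).totallyBounded.subset subset_closure
  -- The radius is `ε / 2` because a bound on the unit sphere yields only a non-strict bound for the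
  -- operator norm.
  obtain ⟨t, htf, ht⟩ := Metric.totallyBounded_iff.1 htb (ε / 2) (by positivity)
  let V : Submodule ℂ Ell2 := Submodule.span ℂ t
  have : FiniteDimensional ℂ V := FiniteDimensional.span_of_finite ℂ htf
  let b := stdOrthonormalBasis ℂ V
  have hP := b.starProjection_eq_sum_rankOne
  let T : Ell2 →L[ℂ] Ell2 := k
  -- With `P` the orthogonal projection onto the span `V` of the net, `PT` is the sum of the rank
  -- one operators `ξ ↦ ⟨T* b_i, ξ⟩ b_i`.
  let F : Compacts := ∑ i, compactRankOne (b i) (star T (b i : Ell2))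
  have hF : (F : Ell2 →L[ℂ] Ell2) = V.starProjection * T := by
    rw [hP, Finset.sum_mul, AddSubmonoidClass.coe_finsetSum]
    refine Finset.sum_congr rfl fun i _ => ?_
    change rankOne ℂ (b i : Ell2) (star T (b i : Ell2)) = _
    rw [ContinuousLinearMap.star_eq_adjoint]
    exact (rankOne_comp _ _ _).symm
  refine ⟨F, sum_mem fun i _ => compactRankOne_mem hS h _ _, ?_⟩
  rw [dist_eq_norm]
  change ‖T - (F : Ell2 →L[ℂ] Ell2)‖ < ε
  rw [hF]
  refine lt_of_le_of_lt (ContinuousLinearMap.opNorm_le_of_unit_norm (C := ε / 2) (by positivity)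
    fun x hx => ?_) (by linarith)
  obtain ⟨y, hy, hxy⟩ := Set.mem_iUnion₂.1 (ht ⟨x, by simp [hx], rfl⟩)
  -- The projection realises the distance to `V`, so it does at least as well as the nearby net
  -- point `y`.
  have h1 : ‖T x - V.starProjection (T x)‖ ≤ ‖T x - y‖ := by
    have := V.starProjection_minimal (T x)
    rw [this]
    exact ciInf_le ⟨0, by rintro _ ⟨z, rfl⟩; positivity⟩ (⟨y, Submodule.subset_span hy⟩ : V)
  refine h1.trans ?_
  rw [← dist_eq_norm]
  exact (Metric.mem_ball.1 hxy).le

end Compacts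

/-! ### The shift and the diagonal rotation on `ℓ²(ℕ)`. -/

section Shift

open scoped InnerProductSpace
open InnerProductSpace

/-- The isometry of `ℓ²(ℕ)` sending the standard basis to the orthonormal sequence `v`. -/
def isometryOfOrthonormal {v : ℕ → Ell2} (hv : Orthonormal ℂ v) : Ell2 →L[ℂ] Ell2 :=
  hv.orthogonalFamily.linearIsometry.toContinuousLinearMap

theorem isometryOfOrthonormal_basisVec {v : ℕ → Ell2} (hv : Orthonormal ℂ v) (i : ℕ) :
    isometryOfOrthonormal hv (basisVec i) = v i := by
  have := hv.orthogonalFamily.linearIsometry_apply_single (i := i) (1 : ℂ)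
  rw [LinearIsometry.toSpanSingleton_apply, one_smul] at this
  exact this

theorem star_isometryOfOrthonormal_mul_self {v : ℕ → Ell2} (hv : Orthonormal ℂ v) :
    star (isometryOfOrthonormal hv) * isometryOfOrthonormal hv = 1 := by
  ext1 x
  refine ext_inner_left ℂ fun y => ?_
  rw [mul_apply_eq_comp, ContinuousLinearMap.star_eq_adjoint,
    ContinuousLinearMap.adjoint_inner_right]
  exact hv.orthogonalFamily.linearIsometry.inner_map_map y x

/-- The unilateral shift. -/
def shift : Ell2 →L[ℂ] Ell2 :=
  isometryOfOrthonormal (orthonormal_basisVec.comp Nat.succ Nat.succ_injective)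

theorem shift_basisVec (i : ℕ) : shift (basisVec i) = basisVec (i + 1) :=
  isometryOfOrthonormal_basisVec _ _

theorem star_shift_mul_shift : star shift * shift = 1 :=
  star_isometryOfOrthonormal_mul_self _

theorem shift_pow_basisVec (n : ℕ) : (shift ^ n) (basisVec 0) = basisVec n := by
  induction n with
  | zero => simp
  | succ n ih => rw [pow_succ', mul_apply_eq_comp, ih, shift_basisVec]

/-- The rank one projection onto the first basis vector. -/
def baseProj : Ell2 →L[ℂ] Ell2 := rankOne ℂ (basisVec 0) (basisVec 0)

theorem star_shift_basisVec_zero : star shift (basisVec 0) = 0 := by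
  ext i
  rw [← inner_basisVec_left, ContinuousLinearMap.star_eq_adjoint,
    ContinuousLinearMap.adjoint_inner_right, shift_basisVec, inner_basisVec_left, basisVec_apply]
  simp

theorem one_sub_shift_mul_star : 1 - shift * star shift = baseProj := by
  refine clm_ext_basisVec fun i => ?_
  have h0 : baseProj (basisVec i) = (if 0 = i then (1 : ℂ) else 0) • basisVec 0 := by
    rw [baseProj, rankOne_apply, inner_basisVec_left, basisVec_apply]
  rw [h0, sub_apply, one_apply_eq_self, mul_apply_eq_comp]
  cases i with
  | zero => rw [star_shift_basisVec_zero]; simp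
  | succ i =>
    rw [← shift_basisVec, ← mul_apply_eq_comp (star shift), star_shift_mul_shift]
    simp

/-- The counterpart for the shift of the columns `wⁱ q`; this is what matches them with the `x_i`.
-/
theorem coe_matrixCol_eq (i : ℕ) :
    (matrixCol i : Ell2 →L[ℂ] Ell2) = shift ^ i * baseProj := by
  rw [coe_matrixCol, baseProj, mul_rankOne, shift_pow_basisVec]

theorem baseProj_ne_zero : baseProj ≠ 0 := by
  intro h
  have := norm_rankOne (𝕜 := ℂ) (basisVec 0) (basisVec 0)
  rw [baseProj] at h
  rw [h, orthonormal_basisVec.1 0] at this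
  simp at this

theorem orthonormal_smul_basisVec {z : ℂ} (hz : ‖z‖ = 1) :
    Orthonormal ℂ fun i => z ^ i • basisVec i := by
  refine ⟨fun i => by rw [norm_smul, norm_pow, hz, one_pow, one_mul, orthonormal_basisVec.1],
    fun i j hij => ?_⟩
  change ⟪z ^ i • basisVec i, z ^ j • basisVec j⟫_ℂ = 0
  rw [inner_smul_left, inner_smul_right, orthonormal_basisVec.2 hij, mul_zero, mul_zero]

/-- The diagonal unitary with eigenvalues `1, z, z², …`. -/
def diagRot {z : ℂ} (hz : ‖z‖ = 1) : Ell2 →L[ℂ] Ell2 :=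
  isometryOfOrthonormal (orthonormal_smul_basisVec hz)

variable {z : ℂ} (hz : ‖z‖ = 1)

theorem diagRot_basisVec (i : ℕ) : diagRot hz (basisVec i) = z ^ i • basisVec i :=
  isometryOfOrthonormal_basisVec _ _

theorem star_diagRot_mul_diagRot : star (diagRot hz) * diagRot hz = 1 :=
  star_isometryOfOrthonormal_mul_self _

theorem diagRot_mul_star_diagRot : diagRot hz * star (diagRot hz) = 1 := by
  have hz0 : z ≠ 0 := by rintro rfl; simp at hz
  refine clm_ext_basisVec fun i => ?_
  -- The vector `zⁱ e_i` lies in the range of the isometry and is fixed by its range projection; the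
  -- nonzero scalar then cancels.
  have h : (diagRot hz * star (diagRot hz)) (z ^ i • basisVec i) = z ^ i • basisVec i := by
    rw [← diagRot_basisVec hz, mul_apply_eq_comp, ← mul_apply_eq_comp (star (diagRot hz)),
      star_diagRot_mul_diagRot, one_apply_eq_self]
  rw [map_smul] at h
  exact smul_right_injective _ (pow_ne_zero i hz0) h

/-- This commutation is the source of the twist by `λ` in the model. -/
theorem diagRot_mul_shift : diagRot hz * shift = z • (shift * diagRot hz) := by
  refine clm_ext_basisVec fun i => ?_
  rw [smul_apply, mul_apply_eq_comp, mul_apply_eq_comp, shift_basisVec, diagRot_basisVec,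
    diagRot_basisVec, map_smul, shift_basisVec, smul_smul, pow_succ']

/-- The eigenvalue at `e_0` is `z⁰ = 1`, so the rotation is invisible in the corner at `e₀₀`. -/
theorem diagRot_mul_baseProj : diagRot hz * baseProj = baseProj := by
  rw [baseProj, mul_rankOne, diagRot_basisVec, pow_zero, one_smul]

end Shift

end TwistedIsometries
end

noncomputable section

namespace TwistedIsometries

open scoped CStarAlgebra

universe u

/-! ### Universal properties of the free product and its two factors. -/

namespace FreeProduct

variable {A B : Type u} [CStarAlgebra A] [CStarAlgebra B]

variable (A B) in
/-- The canonical map of the first factor as a unital *-homomorphism. -/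
def inlHom : A →⋆ₐ[ℂ] FreeProduct A B :=
  starAlgHomOfMapOne
    (ofAlgebraRels (R := freeProductRels A B) (j := Sum.inl) fun _ h => .inl (.inl h))
    (by
      have := UnivCStar.mk_eq_zero (freeProductRels A B)
        (r := .gen (Sum.inl 1) - 1) (.inr (.inl rfl))
      rwa [UnivCStar.mk_sub, sub_eq_zero, UnivCStar.mk_one] at this)

variable (A B) in
/-- The canonical map of the second factor as a unital *-homomorphism. -/
def inrHom : B →⋆ₐ[ℂ] FreeProduct A B :=
  starAlgHomOfMapOne
    (ofAlgebraRels (R := freeProductRels A B) (j := Sum.inr) fun _ h => .inl (.inr h))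
    (by
      have := UnivCStar.mk_eq_zero (freeProductRels A B)
        (r := .gen (Sum.inr 1) - 1) (.inr (.inr rfl))
      rwa [UnivCStar.mk_sub, sub_eq_zero, UnivCStar.mk_one] at this)

theorem inrHom_apply (b : B) : inrHom A B b = FreeProduct.inr b := rfl

/-- The universal property of the unital free product. -/
theorem exists_lift {C : Type u} [CStarAlgebra C] (φ : A →⋆ₐ[ℂ] C) (ψ : B →⋆ₐ[ℂ] C) :
    ∃ χ : FreeProduct A B →⋆ₐ[ℂ] C,
      (∀ a, χ (FreeProduct.inl a) = φ a) ∧ ∀ b, χ (FreeProduct.inr b) = ψ b := by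
  have hy : IsRep (freeProductRels A B) (Sum.elim φ ψ) := by
    rintro r ((hr | hr) | (rfl | rfl))
    · exact eval_eq_zero_of_mem_algebraRels (j := Sum.inl) (φ : A →⋆ₙₐ[ℂ] C) (fun a => rfl) hr
    · exact eval_eq_zero_of_mem_algebraRels (j := Sum.inr) (ψ : B →⋆ₙₐ[ℂ] C) (fun a => rfl) hr
    · simp
    · simp
  exact ⟨UnivCStar.lift _ _ hy, fun a => UnivCStar.lift_of _ _ hy _,
    fun b => UnivCStar.lift_of _ _ hy _⟩

end FreeProduct

/-- The *-homomorphism `C(S¹) → A` determined by a unitary. -/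
theorem exists_circle_hom {A : Type*} [CStarAlgebra A] {g : A} (hg : g ∈ unitary A) :
    ∃ φ : C(Circle, ℂ) →⋆ₐ[ℂ] A,
      φ (⟨fun z => (z : ℂ), continuous_subtype_val⟩ : C(Circle, ℂ)) = g := by
  have hn : IsStarNormal g := ⟨by
    rw [Commute, SemiconjBy, (Unitary.mem_iff.1 hg).1, (Unitary.mem_iff.1 hg).2]⟩
  -- The spectrum of a unitary lies on the circle: restrict functions to it, and apply the
  -- continuous functional calculus.
  let i : C(spectrum ℂ g, Circle) :=
    ⟨fun z => ⟨z, mem_sphere_zero_iff_norm.2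
      (spectrum.norm_eq_one_of_unitary (𝕜 := ℂ) hg z.2)⟩, by fun_prop⟩
  refine ⟨(cfcHom hn).comp (ContinuousMap.compStarAlgHom' ℂ ℂ i), ?_⟩
  exact cfcHom_id hn

/-- The *-homomorphism `ℂ² → A` determined by a projection. -/
def projHom {A : Type*} [CStarAlgebra A] (e : A) (h1 : star e = e) (h2 : e * e = e) :
    ℂ × ℂ →⋆ₐ[ℂ] A where
  toFun z := z.1 • e + z.2 • (1 - e)
  map_one' := by simp
  map_mul' z w := by
    have h3 : e * (1 - e) = 0 := by rw [mul_sub, h2, mul_one, sub_self]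
    have h4 : (1 - e) * e = 0 := by rw [sub_mul, h2, one_mul, sub_self]
    have h5 : (1 - e) * (1 - e) = 1 - e := by rw [mul_sub, h4, mul_one, sub_zero]
    simp only [Prod.fst_mul, Prod.snd_mul, mul_add, add_mul, smul_mul_smul_comm, h2, h3, h4, h5,
      smul_zero, add_zero, zero_add]
  map_zero' := by simp
  map_add' z w := by simp only [Prod.fst_add, Prod.snd_add, add_smul]; abel
  commutes' c := by
    simp only [Prod.algebraMap_apply, Algebra.algebraMap_self, RingHom.id_apply, ← smul_add]
    rw [add_sub_cancel, Algebra.algebraMap_eq_smul_one]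
  map_star' z := by simp [h1]

theorem projHom_one_zero {A : Type*} [CStarAlgebra A] (e : A) (h1 : star e = e)
    (h2 : e * e = e) : projHom e h1 h2 (1, 0) = e := by
  simp [projHom]

/-! ### Generators of `C(S¹) *_ℂ ℂ²` and uniqueness of homomorphisms. -/

namespace CircleFreeC2

theorem ubar_mem_unitary : ubar ∈ unitary CircleFreeC2 := by
  refine Unitary.map_mem (FreeProduct.inlHom C(Circle, ℂ) (ℂ × ℂ)) (Unitary.mem_iff.2 ⟨?_, ?_⟩)
  · ext z
    change conj (z : ℂ) * (z : ℂ) = 1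
    rw [mul_comm, Complex.mul_conj, Circle.normSq_coe, Complex.ofReal_one]
  · ext z
    change (z : ℂ) * conj (z : ℂ) = 1
    rw [Complex.mul_conj, Circle.normSq_coe, Complex.ofReal_one]

theorem star_ubar_mul_ubar : star ubar * ubar = 1 := (Unitary.mem_iff.1 ubar_mem_unitary).1

theorem ubar_mul_star_ubar : ubar * star ubar = 1 := (Unitary.mem_iff.1 ubar_mem_unitary).2

theorem star_pbar : star pbar = pbar := by
  rw [pbar, ← FreeProduct.inrHom_apply, ← map_star]
  congr 1
  ext <;> simp

theorem pbar_mul_pbar : pbar * pbar = pbar := by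
  rw [pbar, ← FreeProduct.inrHom_apply, ← map_mul]
  simp

/-- A unitary and a projection determine a *-homomorphism out of `C(S¹) *_ℂ ℂ²`. -/
theorem exists_lift {A : Type} [CStarAlgebra A] {g e : A} (hg : g ∈ unitary A)
    (h1 : star e = e) (h2 : e * e = e) :
    ∃ χ : CircleFreeC2 →⋆ₐ[ℂ] A, χ ubar = g ∧ χ pbar = e := by
  obtain ⟨φ, hφ⟩ := exists_circle_hom hg
  obtain ⟨χ, hχ1, hχ2⟩ := FreeProduct.exists_lift φ (projHom e h1 h2)
  exact ⟨χ, (hχ1 _).trans hφ, (hχ2 _).trans (projHom_one_zero e h1 h2)⟩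

/-- `C(S¹) *_ℂ ℂ²` is generated by `ū` and `p̄` as a C*-algebra. -/
theorem mem_of_isClosed {S : StarSubalgebra ℂ CircleFreeC2} (hS : IsClosed (S : Set CircleFreeC2))
    (hu : ubar ∈ S) (hp : pbar ∈ S) (d : CircleFreeC2) : d ∈ S := by
  have hl : ∀ f : C(Circle, ℂ), FreeProduct.inlHom C(Circle, ℂ) (ℂ × ℂ) f ∈ S := by
    let z : C(Circle, ℂ) := ⟨fun z => (z : ℂ), continuous_subtype_val⟩
    let P : StarSubalgebra ℂ C(Circle, ℂ) := S.comap (FreeProduct.inlHom C(Circle, ℂ) (ℂ × ℂ))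
    have hP : IsClosed (P : Set C(Circle, ℂ)) :=
      hS.preimage (map_continuous
        (FreeProduct.inlHom C(Circle, ℂ) (ℂ × ℂ)))
    have hz : z ∈ P := hu
    -- The coordinate `z` alone separates points, so Stone–Weierstrass makes the closed preimage `P`
    -- everything.
    have hsep : P.SeparatesPoints := fun x y hxy =>
      ⟨z, ⟨z, hz, rfl⟩, fun h => hxy (Circle.coe_injective h)⟩
    have := ContinuousMap.starSubalgebra_topologicalClosure_eq_top_of_separatesPoints P hsep
    intro f
    have hf : f ∈ P.topologicalClosure := by rw [this]; trivial
    exact hP.closure_subset hf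
  have hr : ∀ c : ℂ × ℂ, FreeProduct.inrHom C(Circle, ℂ) (ℂ × ℂ) c ∈ S := fun c => by
    have hc : c = c.1 • (1, 0) + c.2 • (1 - (1, 0)) := by ext <;> simp
    rw [hc, map_add, map_smul, map_smul, map_sub, map_one]
    exact add_mem (S.smul_mem hp _) (S.smul_mem (sub_mem (one_mem S) hp) _)
  refine UnivCStar.induction_gen _ (C := fun d => d ∈ S) hS (fun r => S.algebraMap_mem r)
    (fun g => ?_) (fun g => ?_) (fun a b h1 h2 => mul_mem h1 h2) (fun a b h1 h2 => add_mem h1 h2) d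
  · rcases g with f | c
    · exact hl f
    · exact hr c
  · rcases g with f | c
    · exact star_mem (hl f)
    · exact star_mem (hr c)

end CircleFreeC2

/-- Two unital *-homomorphisms of `C(S¹) *_ℂ ℂ²` agree after multiplication with a projection `e`
commuting with their ranges as soon as they do so on `ū` and `p̄`. -/
theorem CircleFreeC2.hom_mul_eq {A : Type*} [CStarAlgebra A] (φ ψ : CircleFreeC2 →⋆ₐ[ℂ] A) {e : A}
    (he : star e = e) (hφ : ∀ d, Commute (φ d) e) (hψ : ∀ d, Commute (ψ d) e)
    (hu : φ ubar * e = ψ ubar * e) (hp : φ pbar * e = ψ pbar * e) (d : CircleFreeC2) :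
    φ d * e = ψ d * e := by
  have hφc : Continuous φ :=
    map_continuous φ
  have hψc : Continuous ψ :=
    map_continuous ψ
  -- Commutation with `e` is what makes this equaliser closed under products and adjoints.
  let S : StarSubalgebra ℂ CircleFreeC2 :=
    { carrier := {d | φ d * e = ψ d * e}
      mul_mem' := fun {a b} ha hb => by
        change φ (a * b) * e = ψ (a * b) * e
        change φ a * e = ψ a * e at ha
        change φ b * e = ψ b * e at hb
        rw [map_mul, map_mul, mul_assoc, hb, (hψ b).eq, ← mul_assoc, ha, mul_assoc, ← (hψ b).eq,
          mul_assoc]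
      add_mem' := fun {a b} ha hb => by
        change φ (a + b) * e = ψ (a + b) * e
        rw [map_add, map_add, add_mul, add_mul]
        exact congrArg₂ (· + ·) ha hb
      algebraMap_mem' := fun c => by
        change φ _ * e = ψ _ * e
        rw [AlgHomClass.commutes φ, AlgHomClass.commutes ψ]
      star_mem' := fun {a} ha => by
        change φ (star a) * e = ψ (star a) * e
        change φ a * e = ψ a * e at ha
        have := congrArg star ha
        rwa [star_mul, star_mul, he, ← map_star, ← map_star, ← (hφ _).eq, ← (hψ _).eq] at this }
  exact mem_of_isClosed (S := S) (isClosed_eq (by fun_prop) (by fun_prop)) hu hp d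

/-- The range of a *-homomorphism of `C(S¹) *_ℂ ℂ²` commutes with a self-adjoint element as soon
as the images of `ū` and `p̄` do. -/
theorem CircleFreeC2.commute_hom {A : Type*} [CStarAlgebra A] (φ : CircleFreeC2 →⋆ₐ[ℂ] A) {e : A}
    (he : star e = e) (hu : Commute (φ ubar) e) (hp : Commute (φ pbar) e) (d : CircleFreeC2) :
    Commute (φ d) e := by
  have hφc : Continuous φ :=
    map_continuous φ
  let S : StarSubalgebra ℂ CircleFreeC2 :=
    { carrier := {d | φ d * e = e * φ d}
      mul_mem' := fun {a b} ha hb => by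
        change Commute (φ (a * b)) e
        rw [map_mul]
        exact Commute.mul_left ha hb
      add_mem' := fun {a b} ha hb => by
        change Commute (φ (a + b)) e
        rw [map_add]
        exact Commute.add_left ha hb
      algebraMap_mem' := fun c => by
        change Commute (φ _) e
        rw [AlgHomClass.commutes φ]
        exact Algebra.commutes c e
      star_mem' := fun {a} ha => by
        change Commute (φ (star a)) e
        have := Commute.star_star (show Commute (φ a) e from ha)
        rwa [he, ← map_star] at this }
  exact mem_of_isClosed (S := S) (isClosed_eq (by fun_prop) (by fun_prop)) hu hp d

end TwistedIsometries
end

noncomputable section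

namespace TwistedIsometries

/-! ### Recognising a closed ideal as a matrix-type span. -/

section ClosedIdeal

variable {A : Type*} [CStarAlgebra A] {s : Set A} {hs : ∀ x ∈ s, star x ∈ s}

theorem mul_mem_closedIdeal_left (a : A) {x : A} (hx : x ∈ closedIdeal s hs) :
    a * x ∈ closedIdeal s hs :=
  map_mem_closure (continuous_const_mul a) hx fun _ h => TwoSidedIdeal.mul_mem_left _ _ _ h

theorem mul_mem_closedIdeal_right (a : A) {x : A} (hx : x ∈ closedIdeal s hs) :
    x * a ∈ closedIdeal s hs :=
  map_mem_closure (f := fun x => x * a) (continuous_mul_const a) hx fun _ h => TwoSidedIdeal.mul_mem_right _ _ _ h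

variable {D : Type*} [CStarAlgebra D] {δ : D →⋆ₙₐ[ℂ] A} {w : ℕ → A}

/-- If `cornerSpan δ w` is a left ideal then it is the closed ideal generated by any of its
self-adjoint subsets whose closed ideal contains all `w i * δ d`. -/
theorem closedIdeal_eq_cornerSpan (hleft : ∀ a, ∀ x ∈ cornerSpan δ w, a * x ∈ cornerSpan δ w)
    (hsub : ∀ x ∈ s, x ∈ cornerSpan δ w) (hmem : ∀ i d, w i * δ d ∈ closedIdeal s hs) :
    (closedIdeal s hs : Set A) = cornerSpan δ w := by
  -- A self-adjoint left ideal is also a right ideal.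
  have hright : ∀ a, ∀ x ∈ cornerSpan δ w, x * a ∈ cornerSpan δ w := fun a x hx => by
    have := star_mem_cornerSpan (hleft (star a) _ (star_mem_cornerSpan hx))
    rwa [star_mul, star_star, star_star] at this
  refine Set.Subset.antisymm ?_ fun x hx => ?_
  · refine closure_minimal (fun x hx => ?_) isClosed_cornerSpan
    refine TwoSidedIdeal.span_induction (p := fun x _ => x ∈ cornerSpan δ w) hsub (zero_mem _)
      (fun x y _ _ h1 h2 => add_mem h1 h2) (fun x _ h => neg_mem h) (fun a x _ h => hleft a x h)
      (fun a x _ h => hright a x h) hx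
  · exact cornerSpan_induction (C := fun x => x ∈ closedIdeal s hs) isClosed_closure
      (fun i j d => mul_mem_closedIdeal_right _ (hmem i d)) (zero_mem _)
      (fun a b h1 h2 => add_mem h1 h2) (fun c a h => SMulMemClass.smul_mem c h) hx

theorem isClosed_forall_mul_mem_cornerSpan :
    IsClosed {a : A | ∀ x ∈ cornerSpan δ w, a * x ∈ cornerSpan δ w} := by
  simp only [Set.ofPred_forall]
  exact isClosed_iInter fun x => isClosed_iInter fun _ =>
    isClosed_cornerSpan.preimage (continuous_mul_const x)

theorem mul_mem_cornerSpan_of_generators {a : A}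
    (hg : ∀ i j d, a * (w i * δ d * star (w j)) ∈ cornerSpan δ w) :
    ∀ x ∈ cornerSpan δ w, a * x ∈ cornerSpan δ w := fun x hx => by
  refine cornerSpan_induction (C := fun x => a * x ∈ cornerSpan δ w)
    (isClosed_cornerSpan.preimage (continuous_const_mul a)) hg ?_ (fun x y h1 h2 => ?_)
    (fun c x h => ?_) hx
  · rw [mul_zero]
    exact zero_mem _
  · rw [mul_add]
    exact add_mem h1 h2
  · rw [mul_smul_comm]
    exact Submodule.smul_mem _ c h

end ClosedIdeal

/-- Compression of a *-homomorphism by a projection commuting with its range. -/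
def cutHom {A D : Type*} [CStarAlgebra A] [CStarAlgebra D] (χ : D →⋆ₐ[ℂ] A) (e : A)
    (h1 : star e = e) (h2 : e * e = e) (hc : ∀ d, Commute (χ d) e) : D →⋆ₙₐ[ℂ] A where
  toFun d := χ d * e
  map_smul' c d := by simp
  map_zero' := by simp
  map_add' a b := by rw [map_add, add_mul]
  map_mul' a b := by
    rw [map_mul, mul_assoc, mul_assoc, ← mul_assoc e, ← (hc b).eq, mul_assoc (χ b), h2]
  map_star' a := by rw [map_star, star_mul, h1, ← map_star, (hc _).eq]

/-- The wandering projection of an isometry is orthogonal to its translates. -/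
theorem star_pow_mul_proj_mul {A : Type*} [CStarAlgebra A] {w : A} (hw : star w * w = 1)
    (i j : ℕ) :
    star (w ^ i * (1 - w * star w)) * (w ^ j * (1 - w * star w)) =
      if i = j then 1 - w * star w else 0 := by
  have hq : star (1 - w * star w) = 1 - w * star w := by simp
  have hqw : (1 - w * star w) * w = 0 := by
    rw [sub_mul, one_mul, mul_assoc, hw, mul_one, sub_self]
  have hwq : star w * (1 - w * star w) = 0 := by
    rw [mul_sub, mul_one, ← mul_assoc, hw, one_mul, sub_self]
  have hqq : (1 - w * star w) * (1 - w * star w) = 1 - w * star w := by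
    rw [mul_sub, mul_one, ← mul_assoc, hqw, zero_mul, sub_zero]
  generalize 1 - w * star w = q at hq hqw hwq hqq
  rw [star_mul, hq, star_pow]
  -- Cancelling `w* w` in the middle lowers both exponents together. If they differ, a factor `q w`
  -- or `w* q` remains, and both vanish.
  induction i generalizing j with
  | zero =>
    cases j with
    | zero => simp [hqq]
    | succ j =>
      rw [if_neg (by omega), pow_zero, mul_one, pow_succ', mul_assoc w, ← mul_assoc, hqw, zero_mul]
  | succ i ih =>
    cases j with
    | zero =>
      rw [if_neg (by omega), pow_succ, pow_zero, one_mul, mul_assoc, mul_assoc (star w ^ i), hwq,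
        mul_zero, mul_zero]
    | succ j =>
      have := ih j
      simp only [Nat.succ_inj]
      rw [← this, pow_succ, pow_succ']
      simp only [mul_assoc]
      rw [← mul_assoc (star w) w, hw, one_mul]

/-! ### Word reduction and identities in the free twist. -/

namespace FreeTwist

variable (θ : ℝ)

/-- The scalar `e^{2πiθ}`. -/
def rot : ℂ := Complex.exp (2 * Real.pi * Complex.I * θ)

theorem norm_rot : ‖rot θ‖ = 1 := by
  have : (2 * Real.pi * Complex.I * θ : ℂ) = ((2 * Real.pi * θ : ℝ) : ℂ) * Complex.I := by
    push_cast; ring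
  rw [rot, this, Complex.norm_exp_ofReal_mul_I]

@[simp] theorem conj_rot_mul_rot : conj (rot θ) * rot θ = 1 := by
  rw [mul_comm, Complex.mul_conj, Complex.normSq_eq_norm_sq, norm_rot]; simp

@[simp] theorem rot_mul_conj_rot : rot θ * conj (rot θ) = 1 := by
  rw [mul_comm, conj_rot_mul_rot]

@[simp] theorem conj_rot_mul_rot_mul (c : ℂ) : conj (rot θ) * (rot θ * c) = c := by
  rw [← mul_assoc, conj_rot_mul_rot, one_mul]

@[simp] theorem star_u_mul_u : star (u θ) * u θ = 1 := by
  have := UnivCStar.mk_eq_zero (freeTwistRels θ) (.inl rfl)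
  rwa [UnivCStar.mk_sub, sub_eq_zero, UnivCStar.mk_mul, UnivCStar.mk_star] at this

@[simp] theorem star_v_mul_v : star (v θ) * v θ = 1 := by
  have := UnivCStar.mk_eq_zero (freeTwistRels θ) (.inr (.inl rfl))
  rwa [UnivCStar.mk_sub, sub_eq_zero, UnivCStar.mk_mul, UnivCStar.mk_star] at this

@[simp] theorem u_mul_v : u θ * v θ = rot θ • (v θ * u θ) := by
  have := UnivCStar.mk_eq_zero (freeTwistRels θ) (.inr (.inr rfl))
  rwa [UnivCStar.mk_sub, sub_eq_zero, UnivCStar.mk_mul, UnivCStar.mk_smul,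
    UnivCStar.mk_mul] at this

@[simp] theorem star_u_mul_star_v : star (u θ) * star (v θ) = rot θ • (star (v θ) * star (u θ)) := by
  have := congrArg star (u_mul_v θ)
  rw [star_mul, star_smul, star_mul] at this
  rw [this, smul_smul, Complex.star_def, rot_mul_conj_rot, one_smul]

-- No relation between `u*` and `v` is imposed, so `u* v` stays as it is; only with a further `u` on
-- the right does it reduce. The rule comes from the overlap of `u* u = 1` with `u v = λ v u`: the
-- word `u* u v` can be read in two ways.
@[simp] theorem star_u_mul_v_mul_u : star (u θ) * (v θ * u θ) = conj (rot θ) • v θ := by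
  have : v θ * u θ = conj (rot θ) • (u θ * v θ) := by
    rw [u_mul_v, smul_smul, conj_rot_mul_rot, one_smul]
  rw [this, mul_smul_comm, ← mul_assoc, star_u_mul_u, one_mul]

-- The other overlap, of `u* v* = λ v* u*` with `v* v = 1`. The variants with a trailing `x` let the
-- rules act inside right-nested products.
@[simp] theorem star_v_mul_star_u_mul_v : star (v θ) * (star (u θ) * v θ) = conj (rot θ) • star (u θ) := by
  have : star (v θ) * star (u θ) = conj (rot θ) • (star (u θ) * star (v θ)) := by
    rw [star_u_mul_star_v, smul_smul, conj_rot_mul_rot, one_smul]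
  rw [← mul_assoc, this, smul_mul_assoc, mul_assoc, star_v_mul_v, mul_one]

@[simp] theorem star_u_mul_u_mul (x : FreeTwist θ) : star (u θ) * (u θ * x) = x := by
  rw [← mul_assoc, star_u_mul_u, one_mul]

@[simp] theorem star_v_mul_v_mul (x : FreeTwist θ) : star (v θ) * (v θ * x) = x := by
  rw [← mul_assoc, star_v_mul_v, one_mul]

@[simp] theorem u_mul_v_mul (x : FreeTwist θ) : u θ * (v θ * x) = rot θ • (v θ * (u θ * x)) := by
  rw [← mul_assoc, u_mul_v, smul_mul_assoc, mul_assoc]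

@[simp] theorem star_u_mul_star_v_mul (x : FreeTwist θ) :
    star (u θ) * (star (v θ) * x) = rot θ • (star (v θ) * (star (u θ) * x)) := by
  rw [← mul_assoc, star_u_mul_star_v, smul_mul_assoc, mul_assoc]

@[simp] theorem star_u_mul_v_mul_u_mul (x : FreeTwist θ) :
    star (u θ) * (v θ * (u θ * x)) = conj (rot θ) • (v θ * x) := by
  rw [← mul_assoc (v θ), ← mul_assoc, star_u_mul_v_mul_u, smul_mul_assoc]

@[simp] theorem star_v_mul_star_u_mul_v_mul (x : FreeTwist θ) :
    star (v θ) * (star (u θ) * (v θ * x)) = conj (rot θ) • (star (u θ) * x) := by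
  rw [← mul_assoc (star (u θ)), ← mul_assoc, star_v_mul_star_u_mul_v, smul_mul_assoc]

/-- The isometry `w = u v`. -/
def w : FreeTwist θ := u θ * v θ

/-- The wandering projection `q = 1 - w w*`. -/
def q : FreeTwist θ := 1 - w θ * star (w θ)

theorem star_w_mul_w : star (w θ) * w θ = 1 := by
  simp only [w, star_mul, mul_assoc, star_u_mul_u_mul, star_v_mul_v]

section Relations

set_option linter.unusedSimpArgs false

/-- This identity and most of those that follow are proved by expanding into words in `u`, `v`,
`u*`, `v*` and reducing with the rules above. -/
theorem star_ubar_mul_ubar : star (ubar θ) * ubar θ = q θ := by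
  simp only [ubar, pbar, q, w, star_mul, star_add, star_sub, star_one, star_star]
  simp [mul_add, add_mul, mul_sub, sub_mul, mul_assoc, smul_sub, smul_smul]

theorem ubar_mul_star_ubar : ubar θ * star (ubar θ) = q θ := by
  simp only [ubar, pbar, q, w, star_mul, star_add, star_sub, star_one, star_star]
  simp [mul_add, add_mul, mul_sub, sub_mul, mul_assoc, smul_sub, smul_smul]

theorem star_pbar : star (pbar θ) = pbar θ := by
  simp only [ubar, pbar, q, w, star_mul, star_add, star_sub, star_one, star_star]
  simp [mul_add, add_mul, mul_sub, sub_mul, mul_assoc, smul_sub, smul_smul]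

theorem pbar_mul_pbar : pbar θ * pbar θ = pbar θ := by
  simp only [ubar, pbar, q, w, star_mul, star_add, star_sub, star_one, star_star]
  simp [mul_add, add_mul, mul_sub, sub_mul, mul_assoc, smul_sub, smul_smul]

theorem star_q : star (q θ) = q θ := by
  simp only [ubar, pbar, q, w, star_mul, star_add, star_sub, star_one, star_star]

theorem q_mul_q : q θ * q θ = q θ := by
  simp only [ubar, pbar, q, w, star_mul, star_add, star_sub, star_one, star_star]
  simp [mul_add, add_mul, mul_sub, sub_mul, mul_assoc, smul_sub, smul_smul]

theorem ubar_mul_q : ubar θ * q θ = ubar θ := by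
  simp only [ubar, pbar, q, w, star_mul, star_add, star_sub, star_one, star_star]
  simp [mul_add, add_mul, mul_sub, sub_mul, mul_assoc, smul_sub, smul_smul]

theorem q_mul_ubar : q θ * ubar θ = ubar θ := by
  simp only [ubar, pbar, q, w, star_mul, star_add, star_sub, star_one, star_star]
  simp [mul_add, add_mul, mul_sub, sub_mul, mul_assoc, smul_sub, smul_smul]

theorem pbar_mul_q : pbar θ * q θ = pbar θ := by
  simp only [ubar, pbar, q, w, star_mul, star_add, star_sub, star_one, star_star]
  simp [mul_add, add_mul, mul_sub, sub_mul, mul_assoc, smul_sub, smul_smul]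

theorem q_mul_pbar : q θ * pbar θ = pbar θ := by
  simp only [ubar, pbar, q, w, star_mul, star_add, star_sub, star_one, star_star]
  simp [mul_add, add_mul, mul_sub, sub_mul, mul_assoc, smul_sub, smul_smul]

/-- This and the next three formulas describe the generators and their adjoints on the range of `q`:
the result has only a part in the corner and a part shifted once by `w`. They make the span an
ideal, and they are the origin of the model. -/
theorem u_mul_q : u θ * q θ = ubar θ - ubar θ * pbar θ + w θ * (ubar θ * pbar θ) := by
  simp only [ubar, pbar, q, w, star_mul, star_add, star_sub, star_one, star_star]
  simp [mul_add, add_mul, mul_sub, sub_mul, mul_assoc, smul_sub, smul_smul]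

theorem v_mul_q : v θ * q θ = pbar θ * star (ubar θ) +
    conj (rot θ) • (w θ * (star (ubar θ) - pbar θ * star (ubar θ))) := by
  simp only [ubar, pbar, q, w, star_mul, star_add, star_sub, star_one, star_star]
  simp [mul_add, add_mul, mul_sub, sub_mul, mul_assoc, smul_sub, smul_smul]

theorem star_u_mul_q : star (u θ) * q θ = star (ubar θ) - pbar θ * star (ubar θ) := by
  simp only [ubar, pbar, q, w, star_mul, star_add, star_sub, star_one, star_star]
  simp [mul_add, add_mul, mul_sub, sub_mul, mul_assoc, smul_sub, smul_smul]

theorem star_v_mul_q : star (v θ) * q θ = ubar θ * pbar θ := by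
  simp only [ubar, pbar, q, w, star_mul, star_add, star_sub, star_one, star_star]
  simp [mul_add, add_mul, mul_sub, sub_mul, mul_assoc, smul_sub, smul_smul]

/-- Together with the next identity, this places both generators of the defect ideal in the corner,
as words in `ū`, `p̄` and `q`. -/
theorem one_sub_u_mul_star : 1 - u θ * star (u θ) = ubar θ * pbar θ * star (ubar θ) := by
  simp only [ubar, pbar, q, w, star_mul, star_add, star_sub, star_one, star_star]
  simp [mul_add, add_mul, mul_sub, sub_mul, mul_assoc, smul_sub, smul_smul]

theorem one_sub_v_mul_star : 1 - v θ * star (v θ) = q θ - pbar θ := by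
  simp only [ubar, pbar, q, w, star_mul, star_add, star_sub, star_one, star_star]
  simp [mul_add, add_mul, mul_sub, sub_mul, mul_assoc, smul_sub, smul_smul]

theorem u_mul_w : u θ * w θ = rot θ • (w θ * u θ) := by
  simp only [ubar, pbar, q, w, star_mul, star_add, star_sub, star_one, star_star]
  simp [mul_add, add_mul, mul_sub, sub_mul, mul_assoc, smul_sub, smul_smul]

theorem v_mul_w : v θ * w θ = conj (rot θ) • (w θ * v θ) := by
  simp only [ubar, pbar, q, w, star_mul, star_add, star_sub, star_one, star_star]
  simp [mul_add, add_mul, mul_sub, sub_mul, mul_assoc, smul_sub, smul_smul]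

/-- An adjoint generator meeting a factor `w` turns into a scalar multiple of the other generator,
so `u*` and `v*` need separate treatment only on the column of index `0`. -/
theorem star_u_mul_w : star (u θ) * w θ = v θ := by
  simp only [ubar, pbar, q, w, star_mul, star_add, star_sub, star_one, star_star]
  simp [mul_add, add_mul, mul_sub, sub_mul, mul_assoc, smul_sub, smul_smul]

theorem star_v_mul_w : star (v θ) * w θ = rot θ • u θ := by
  simp only [ubar, pbar, q, w, star_mul, star_add, star_sub, star_one, star_star]
  simp [mul_add, add_mul, mul_sub, sub_mul, mul_assoc, smul_sub, smul_smul]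

/-- The defect of a product of isometries, split into the two given defects; hence `q` belongs to
the ideal they generate. -/
theorem q_eq : q θ = (1 - u θ * star (u θ)) + u θ * (1 - v θ * star (v θ)) * star (u θ) := by
  simp only [ubar, pbar, q, w, star_mul, star_add, star_sub, star_one, star_star]
  simp [mul_add, add_mul, mul_sub, sub_mul, mul_assoc, smul_sub, smul_smul]

end Relations

end FreeTwist

end TwistedIsometries
end

noncomputable section

namespace TwistedIsometries

/-! ### The corner at `q` and the structure of the defect ideal. -/

namespace FreeTwist

variable (θ : ℝ)

/-- `ū` is unitary only relative to `q`. Adding `1 - q` gives a unitary of the whole algebra, as the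
unital free product requires; the summand is removed again when cutting by `q`. -/
theorem ubar_add_mem_unitary : ubar θ + (1 - q θ) ∈ unitary (FreeTwist θ) := by
  have h1 : star (ubar θ) * q θ = star (ubar θ) := by
    rw [← star_q, ← star_mul, q_mul_ubar]
  have h2 : q θ * star (ubar θ) = star (ubar θ) := by
    rw [← star_q, ← star_mul, ubar_mul_q]
  have h3 : star (ubar θ + (1 - q θ)) = star (ubar θ) + (1 - q θ) := by
    rw [star_add, star_sub, star_one, star_q]
  refine Unitary.mem_iff.2 ⟨?_, ?_⟩
  · rw [h3]
    simp only [add_mul, mul_add, mul_sub, sub_mul, mul_one, one_mul, h1, q_mul_ubar,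
      star_ubar_mul_ubar, q_mul_q]
    abel
  · rw [h3]
    simp only [add_mul, mul_add, mul_sub, sub_mul, mul_one, one_mul, h2, ubar_mul_q,
      ubar_mul_star_ubar, q_mul_q]
    abel

/-- The unital *-homomorphism `C(S¹) *_ℂ ℂ² → A` sending `ū` to `ū + w w*` and `p̄` to `p̄`. -/
def cornerHom : CircleFreeC2 →⋆ₐ[ℂ] FreeTwist θ :=
  (CircleFreeC2.exists_lift (ubar_add_mem_unitary θ) (star_pbar θ) (pbar_mul_pbar θ)).choose

theorem cornerHom_ubar : cornerHom θ CircleFreeC2.ubar = ubar θ + (1 - q θ) :=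
  (CircleFreeC2.exists_lift (ubar_add_mem_unitary θ) (star_pbar θ)
    (pbar_mul_pbar θ)).choose_spec.1

theorem cornerHom_pbar : cornerHom θ CircleFreeC2.pbar = pbar θ :=
  (CircleFreeC2.exists_lift (ubar_add_mem_unitary θ) (star_pbar θ)
    (pbar_mul_pbar θ)).choose_spec.2

theorem commute_cornerHom_q (d : CircleFreeC2) : Commute (cornerHom θ d) (q θ) := by
  refine CircleFreeC2.commute_hom _ (star_q θ) ?_ ?_ d
  · rw [cornerHom_ubar]
    change _ * _ = _ * _
    rw [add_mul, mul_add, sub_mul, mul_sub, ubar_mul_q, q_mul_ubar, one_mul, mul_one]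
  · rw [cornerHom_pbar]
    exact (pbar_mul_q θ).trans (q_mul_pbar θ).symm

/-- The *-homomorphism of `C(S¹) *_ℂ ℂ²` onto the corner `q A q`. -/
def corner : CircleFreeC2 →⋆ₙₐ[ℂ] FreeTwist θ :=
  cutHom (cornerHom θ) (q θ) (star_q θ) (q_mul_q θ) (commute_cornerHom_q θ)

theorem corner_apply (d : CircleFreeC2) : corner θ d = cornerHom θ d * q θ := rfl

theorem corner_ubar : corner θ CircleFreeC2.ubar = ubar θ := by
  rw [corner_apply, cornerHom_ubar, add_mul, sub_mul, one_mul, q_mul_q, sub_self, add_zero,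
    ubar_mul_q]

theorem corner_pbar : corner θ CircleFreeC2.pbar = pbar θ := by
  rw [corner_apply, cornerHom_pbar, pbar_mul_q]

theorem corner_one : corner θ 1 = q θ := by rw [corner_apply, map_one, one_mul]

theorem q_mul_corner (d : CircleFreeC2) : q θ * corner θ d = corner θ d := by
  rw [← corner_one, ← map_mul, one_mul]

theorem corner_mul_q (d : CircleFreeC2) : corner θ d * q θ = corner θ d := by
  rw [← corner_one, ← map_mul, mul_one]

/-- The wandering partial isometries `wⁱ q`. -/
def col (i : ℕ) : FreeTwist θ := w θ ^ i * q θ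

theorem star_col_mul_col (i j : ℕ) :
    star (col θ i) * col θ j = if i = j then corner θ 1 else 0 := by
  rw [corner_one]
  exact star_pow_mul_proj_mul (star_w_mul_w θ) i j

theorem col_mul_corner (i : ℕ) (d : CircleFreeC2) :
    col θ i * corner θ d = w θ ^ i * corner θ d := by
  rw [col, mul_assoc, q_mul_corner]

/-- The closed span of the elements `wⁱ δ(d) w*ʲ`. -/
abbrev stable : Submodule ℂ (FreeTwist θ) := cornerSpan (corner θ) (col θ)

theorem mem_stable (i j : ℕ) (d : CircleFreeC2) :
    w θ ^ i * (corner θ d * star (col θ j)) ∈ stable θ := by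
  have := mem_cornerSpan (δ := corner θ) (w := col θ) i j d
  rwa [col_mul_corner, mul_assoc] at this

theorem mul_w_pow {a : FreeTwist θ} {c : ℂ} (h : a * w θ = c • (w θ * a)) (i : ℕ) :
    a * w θ ^ i = c ^ i • (w θ ^ i * a) := by
  induction i with
  | zero => simp
  | succ i ih =>
    rw [pow_succ, ← mul_assoc, ih, smul_mul_assoc, mul_assoc, h, mul_smul_comm, smul_smul,
      ← mul_assoc, ← pow_succ]

/-- Moving `u` past `wⁱ` costs the scalar `λⁱ`, and `u_mul_q` splits the rest into terms in columns
`i` and `i + 1`. -/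
theorem u_mul_mem_stable : ∀ x ∈ stable θ, u θ * x ∈ stable θ := by
  refine mul_mem_cornerSpan_of_generators fun i j d => ?_
  have h1 : u θ * corner θ d =
      corner θ ((CircleFreeC2.ubar - CircleFreeC2.ubar * CircleFreeC2.pbar) * d) +
        w θ * corner θ (CircleFreeC2.ubar * CircleFreeC2.pbar * d) := by
    rw [← q_mul_corner θ d, ← mul_assoc, u_mul_q]
    simp only [map_mul, map_sub, corner_ubar, corner_pbar, add_mul, mul_assoc]
  have h2 : u θ * (col θ i * corner θ d * star (col θ j)) = rot θ ^ i • (w θ ^ i *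
      (corner θ ((CircleFreeC2.ubar - CircleFreeC2.ubar * CircleFreeC2.pbar) * d) *
        star (col θ j)) + w θ ^ (i + 1) *
      (corner θ (CircleFreeC2.ubar * CircleFreeC2.pbar * d) * star (col θ j))) := by
    rw [col_mul_corner, ← mul_assoc, ← mul_assoc, mul_w_pow θ (u_mul_w θ), smul_mul_assoc,
      smul_mul_assoc, mul_assoc (w θ ^ i), h1, pow_succ]
    simp only [mul_add, add_mul, mul_assoc]
  rw [h2]
  exact Submodule.smul_mem _ _ (add_mem (mem_stable θ _ _ _) (mem_stable θ _ _ _))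

theorem v_mul_mem_stable : ∀ x ∈ stable θ, v θ * x ∈ stable θ := by
  refine mul_mem_cornerSpan_of_generators fun i j d => ?_
  have h1 : v θ * corner θ d =
      corner θ (CircleFreeC2.pbar * star CircleFreeC2.ubar * d) +
        conj (rot θ) • (w θ * corner θ ((star CircleFreeC2.ubar -
          CircleFreeC2.pbar * star CircleFreeC2.ubar) * d)) := by
    rw [← q_mul_corner θ d, ← mul_assoc, v_mul_q]
    simp only [map_mul, map_sub, map_star, corner_ubar, corner_pbar, add_mul, mul_assoc,
      smul_mul_assoc]
  have h2 : v θ * (col θ i * corner θ d * star (col θ j)) = conj (rot θ) ^ i • (w θ ^ i *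
      (corner θ (CircleFreeC2.pbar * star CircleFreeC2.ubar * d) *
        star (col θ j)) + conj (rot θ) • (w θ ^ (i + 1) *
      (corner θ ((star CircleFreeC2.ubar -
          CircleFreeC2.pbar * star CircleFreeC2.ubar) * d) * star (col θ j)))) := by
    rw [col_mul_corner, ← mul_assoc, ← mul_assoc, mul_w_pow θ (v_mul_w θ), smul_mul_assoc,
      smul_mul_assoc, mul_assoc (w θ ^ i), h1, pow_succ]
    simp only [mul_add, add_mul, mul_assoc, mul_smul_comm, smul_mul_assoc]
  rw [h2]
  exact Submodule.smul_mem _ _ (add_mem (mem_stable θ _ _ _)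
    (Submodule.smul_mem _ _ (mem_stable θ _ _ _)))

/-- On the column of index `0` the product stays there by `star_u_mul_q`. On later columns `u* w =
v` reduces the claim to the one for `v`. -/
theorem star_u_mul_mem_stable : ∀ x ∈ stable θ, star (u θ) * x ∈ stable θ := by
  refine mul_mem_cornerSpan_of_generators fun i j d => ?_
  rw [col_mul_corner]
  cases i with
  | zero =>
    have h1 : star (u θ) * (w θ ^ 0 * corner θ d * star (col θ j)) = w θ ^ 0 *
        (corner θ ((star CircleFreeC2.ubar -
          CircleFreeC2.pbar * star CircleFreeC2.ubar) * d) * star (col θ j)) := by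
      rw [pow_zero, one_mul, one_mul, ← q_mul_corner θ d, ← mul_assoc, ← mul_assoc, star_u_mul_q]
      simp only [map_mul, map_sub, map_star, corner_ubar, corner_pbar]
    rw [h1]
    exact mem_stable θ _ _ _
  | succ i =>
    have h1 : star (u θ) * (w θ ^ (i + 1) * corner θ d * star (col θ j)) =
        v θ * (w θ ^ i * (corner θ d * star (col θ j))) := by
      have h2 : star (u θ) * (w θ ^ (i + 1) * corner θ d * star (col θ j)) =
          star (u θ) * w θ * (w θ ^ i * (corner θ d * star (col θ j))) := by
        rw [pow_succ']; simp only [mul_assoc]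
      rw [h2, star_u_mul_w]
    rw [h1]
    exact v_mul_mem_stable θ _ (mem_stable θ _ _ _)

theorem star_v_mul_mem_stable : ∀ x ∈ stable θ, star (v θ) * x ∈ stable θ := by
  refine mul_mem_cornerSpan_of_generators fun i j d => ?_
  rw [col_mul_corner]
  cases i with
  | zero =>
    have h1 : star (v θ) * (w θ ^ 0 * corner θ d * star (col θ j)) = w θ ^ 0 *
        (corner θ (CircleFreeC2.ubar * CircleFreeC2.pbar * d) * star (col θ j)) := by
      rw [pow_zero, one_mul, one_mul, ← q_mul_corner θ d, ← mul_assoc, ← mul_assoc, star_v_mul_q]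
      simp only [map_mul, corner_ubar, corner_pbar]
    rw [h1]
    exact mem_stable θ _ _ _
  | succ i =>
    have h1 : star (v θ) * (w θ ^ (i + 1) * corner θ d * star (col θ j)) =
        rot θ • (u θ * (w θ ^ i * (corner θ d * star (col θ j)))) := by
      have h2 : star (v θ) * (w θ ^ (i + 1) * corner θ d * star (col θ j)) =
        star (v θ) * w θ * (w θ ^ i * (corner θ d * star (col θ j))) := by
        rw [pow_succ']; simp only [mul_assoc]
      rw [h2, star_v_mul_w, smul_mul_assoc]
    rw [h1]
    exact Submodule.smul_mem _ _ (u_mul_mem_stable θ _ (mem_stable θ _ _ _))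

theorem mul_mem_stable (a : FreeTwist θ) : ∀ x ∈ stable θ, a * x ∈ stable θ := by
  refine UnivCStar.induction_gen _ (C := fun a => ∀ x ∈ stable θ, a * x ∈ stable θ)
    isClosed_forall_mul_mem_cornerSpan (fun r x hx => ?_) (fun g => ?_) (fun g => ?_)
    (fun a b ha hb x hx => ?_) (fun a b ha hb x hx => ?_) a
  · rw [← Algebra.smul_def]
    exact Submodule.smul_mem _ _ hx
  · cases g
    · exact u_mul_mem_stable θ
    · exact v_mul_mem_stable θ
  · cases g
    · exact star_u_mul_mem_stable θ
    · exact star_v_mul_mem_stable θ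
  · rw [mul_assoc]
    exact ha _ (hb _ hx)
  · rw [add_mul]
    exact add_mem (ha _ hx) (hb _ hx)

theorem corner_mem_stable (d : CircleFreeC2) : corner θ d ∈ stable θ := by
  have := mem_cornerSpan (δ := corner θ) (w := col θ) 0 0 d
  rwa [col, pow_zero, one_mul, q_mul_corner, star_q, corner_mul_q] at this

theorem q_mem_defectIdeal : q θ ∈ defectIdeal θ := by
  have h1 : 1 - u θ * star (u θ) ∈ defectIdeal θ := subset_closedIdeal _ _ (.inl rfl)
  have h2 : 1 - v θ * star (v θ) ∈ defectIdeal θ := subset_closedIdeal _ _ (.inr rfl)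
  rw [q_eq]
  exact add_mem h1 (mul_mem_closedIdeal_right _ (mul_mem_closedIdeal_left _ h2))

/-- The span is a left ideal containing both defects, and conversely each `wⁱ δ(d)` is a multiple of
`q`, which lies in the defect ideal. -/
theorem defectIdeal_eq : (defectIdeal θ : Set (FreeTwist θ)) = cornerSpan (corner θ) (col θ) := by
  refine closedIdeal_eq_cornerSpan (mul_mem_stable θ) ?_ fun i d => ?_
  · rintro x (rfl | rfl)
    · rw [one_sub_u_mul_star, ← corner_ubar, ← corner_pbar, ← map_star, ← map_mul, ← map_mul]
      exact corner_mem_stable θ _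
    · rw [one_sub_v_mul_star, ← corner_one, ← corner_pbar, ← map_sub]
      exact corner_mem_stable θ _
  · rw [← corner_mul_q, ← mul_assoc]
    exact mul_mem_closedIdeal_left _ (q_mem_defectIdeal θ)

end FreeTwist

end TwistedIsometries
end

noncomputable section

namespace TwistedIsometries

/-! ### The tensor product with `𝒦` as a matrix-type span. -/

namespace TensorAmbient

open scoped CStarAlgebra

variable (D : Type) [CStarAlgebra D]

/-- The canonical unital *-homomorphism `d ↦ d ⊗ 1`. -/
def inlHom : D →⋆ₐ[ℂ] TensorAmbient D Compacts :=
  starAlgHomOfMapOne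
    (ofAlgebraRels (R := tensorRels D Compacts) (j := Sum.inl) fun _ h => .inl (.inl (.inl h)))
    (by
      have := UnivCStar.mk_eq_zero (tensorRels D Compacts)
        (r := .gen (Sum.inl 1) - 1) (.inl (.inr rfl))
      rwa [UnivCStar.mk_sub, sub_eq_zero, UnivCStar.mk_one] at this)

/-- The canonical *-homomorphism `k ↦ 1 ⊗ k`. -/
def inrHom : Compacts →⋆ₙₐ[ℂ] TensorAmbient D Compacts :=
  ofAlgebraRels (R := tensorRels D Compacts) (j := Sum.inr) fun _ h => .inl (.inl (.inr h))

variable {D}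

theorem commute_inlHom_inrHom (d : D) (k : Compacts) : Commute (inlHom D d) (inrHom D k) := by
  have := UnivCStar.mk_eq_zero (tensorRels D Compacts) (.inr ⟨d, k, rfl⟩)
  rwa [UnivCStar.mk_sub, UnivCStar.mk_mul, UnivCStar.mk_mul, sub_eq_zero] at this

theorem preTmul_eq (d : D) (k : Compacts) : preTmul d k = inlHom D d * inrHom D k := rfl

variable (D) in
/-- The corner embedding `d ↦ d ⊗ e₀₀`. -/
def corner : D →⋆ₙₐ[ℂ] TensorAmbient D Compacts :=
  cutHom (inlHom D) (inrHom D (matrixCol 0)) (by rw [← map_star, star_matrixCol_zero])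
    (by rw [← map_mul, matrixCol_mul_matrixCol_zero]) fun d => commute_inlHom_inrHom d _

theorem corner_apply (d : D) : corner D d = inlHom D d * inrHom D (matrixCol 0) := rfl

variable (D) in
/-- The elements `1 ⊗ x_i`. -/
def col (i : ℕ) : TensorAmbient D Compacts := inrHom D (matrixCol i)

theorem star_col_mul_col (i j : ℕ) :
    star (col D i) * col D j = if i = j then corner D 1 else 0 := by
  rw [col, col, ← map_star, ← map_mul, star_matrixCol_mul_matrixCol, corner_apply, map_one,
    one_mul]
  split_ifs
  · rfl
  · exact map_zero _

theorem col_mul_corner (i : ℕ) (d : D) : col D i * corner D d = preTmul d (matrixCol i) := by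
  rw [col, corner_apply, ← mul_assoc, ← (commute_inlHom_inrHom d _).eq, mul_assoc, ← map_mul,
    matrixCol_mul_matrixCol_zero, preTmul_eq]

theorem col_mul_corner_mul_star (i j : ℕ) (d : D) : col D i * corner D d * star (col D j) =
    preTmul d (matrixCol i * star (matrixCol j)) := by
  rw [col_mul_corner, col, preTmul_eq, preTmul_eq, ← map_star, mul_assoc, ← map_mul]

/-- For fixed `d` the elementary tensor is continuous and linear in `k`, so density of the span of
matrix units reduces the claim to generators. -/
theorem preTmul_mem_cornerSpan (d : D) (k : Compacts) :
    preTmul d k ∈ cornerSpan (corner D) (col D) := by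
  let f : Compacts →ₗ[ℂ] TensorAmbient D Compacts :=
    { toFun := fun k => preTmul d k
      map_add' := fun k l => by rw [preTmul_eq, map_add, mul_add]; rfl
      map_smul' := fun c k => by
        rw [preTmul_eq, map_smul, mul_smul_comm]; rfl }
  have hf : Continuous f :=
    (map_continuous (inrHom D)).const_mul (inlHom D d)
  refine compacts_mem_of_matrixCol (S := (cornerSpan (corner D) (col D)).comap f)
    (isClosed_cornerSpan.preimage hf) (fun i j => ?_) k
  change preTmul d (matrixCol i * star (matrixCol j)) ∈ cornerSpan (corner D) (col D)
  rw [← col_mul_corner_mul_star]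
  exact mem_cornerSpan i j d

theorem inlHom_mul_mem_cornerSpan (a : D) :
    ∀ x ∈ cornerSpan (corner D) (col D), inlHom D a * x ∈ cornerSpan (corner D) (col D) := by
  refine mul_mem_cornerSpan_of_generators fun i j d => ?_
  rw [col_mul_corner_mul_star, preTmul_eq, ← mul_assoc, ← map_mul, ← preTmul_eq]
  exact preTmul_mem_cornerSpan _ _

theorem inrHom_mul_mem_cornerSpan (k : Compacts) :
    ∀ x ∈ cornerSpan (corner D) (col D), inrHom D k * x ∈ cornerSpan (corner D) (col D) := by
  refine mul_mem_cornerSpan_of_generators fun i j d => ?_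
  rw [col_mul_corner_mul_star, preTmul_eq, ← mul_assoc, ← (commute_inlHom_inrHom d k).eq,
    mul_assoc, ← map_mul, ← preTmul_eq]
  exact preTmul_mem_cornerSpan _ _

theorem mul_mem_cornerSpan (a : TensorAmbient D Compacts) :
    ∀ x ∈ cornerSpan (corner D) (col D), a * x ∈ cornerSpan (corner D) (col D) := by
  refine UnivCStar.induction_gen _
    (C := fun a => ∀ x ∈ cornerSpan (corner D) (col D), a * x ∈ cornerSpan (corner D) (col D))
    isClosed_forall_mul_mem_cornerSpan (fun r x hx => ?_) (fun g => ?_) (fun g => ?_)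
    (fun a b ha hb x hx => ?_) (fun a b ha hb x hx => ?_) a
  · rw [← Algebra.smul_def]
    exact Submodule.smul_mem _ _ hx
  · rcases g with d | k
    · exact inlHom_mul_mem_cornerSpan d
    · exact inrHom_mul_mem_cornerSpan k
  · rcases g with d | k
    · have := inlHom_mul_mem_cornerSpan (star d)
      rwa [map_star] at this
    · have := inrHom_mul_mem_cornerSpan (D := D) (star k)
      rwa [map_star] at this
  · rw [mul_assoc]
    exact ha _ (hb _ hx)
  · rw [add_mul]
    exact add_mem (ha _ hx) (hb _ hx)

variable (D) in
theorem cStarTensor_eq : (CStarTensor D Compacts : Set (TensorAmbient D Compacts)) =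
    cornerSpan (corner D) (col D) := by
  refine closedIdeal_eq_cornerSpan mul_mem_cornerSpan ?_ fun i d => ?_
  · rintro _ ⟨d, k, rfl⟩
    exact preTmul_mem_cornerSpan d k
  · exact subset_closedIdeal _ _ ⟨d, matrixCol i, col_mul_corner i d⟩

variable (D) in
/-- The canonical map of the universal algebra of `D` and `𝒦` to that of `D` and `B(ℓ²)`. -/
theorem exists_toUnitalTensor :
    ∃ β : TensorAmbient D Compacts →⋆ₐ[ℂ] UnitalTensor D (Ell2 →L[ℂ] Ell2),
      ∀ d k, β (preTmul d k) = UnitalTensor.inl _ _ d * UnitalTensor.inr _ _ (k : Ell2 →L[ℂ] Ell2) := by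
  let ι : Compacts →⋆ₙₐ[ℂ] UnitalTensor D (Ell2 →L[ℂ] Ell2) :=
    ((UnitalTensor.inr D (Ell2 →L[ℂ] Ell2) : _ →⋆ₐ[ℂ] _) :
      (Ell2 →L[ℂ] Ell2) →⋆ₙₐ[ℂ] UnitalTensor D (Ell2 →L[ℂ] Ell2)).comp
      (NonUnitalStarSubalgebraClass.subtype Compacts)
  have hy : IsRep (tensorRels D Compacts)
      (Sum.elim (UnitalTensor.inl D (Ell2 →L[ℂ] Ell2)) ι) := by
    rintro r (((hr | hr) | hr) | ⟨a, b, rfl⟩)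
    · exact eval_eq_zero_of_mem_algebraRels (j := Sum.inl)
        (UnitalTensor.inl D (Ell2 →L[ℂ] Ell2) : D →⋆ₙₐ[ℂ] _) (fun a => rfl) hr
    · exact eval_eq_zero_of_mem_algebraRels (j := Sum.inr) ι (fun a => rfl) hr
    · rw [Set.mem_singleton_iff.1 hr]; simp
    · rw [map_sub, map_mul, map_mul, sub_eq_zero]
      simp only [StarPoly.eval_gen, Sum.elim_inl, Sum.elim_inr]
      exact (UnitalTensor.commute_inl_inr a (b : Ell2 →L[ℂ] Ell2)).eq
  refine ⟨UnivCStar.lift _ _ hy, fun d k => ?_⟩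
  rw [preTmul, map_mul, UnivCStar.lift_of, UnivCStar.lift_of]
  rfl

end TensorAmbient

end TwistedIsometries
end

noncomputable section

namespace TwistedIsometries

/-! ### Arithmetic of elementary tensors. -/

namespace UnitalTensor

variable {A B : Type} [CStarAlgebra A] [CStarAlgebra B]

/-- The elementary tensor `a ⊗ b`. -/
def elem (a : A) (b : B) : UnitalTensor A B := inl A B a * inr A B b

theorem elem_mul_elem (a a' : A) (b b' : B) : elem a b * elem a' b' = elem (a * a') (b * b') := by
  rw [elem, elem, elem, map_mul, map_mul, mul_assoc, ← mul_assoc (inr A B b),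
    ← (commute_inl_inr a' b).eq]
  simp only [mul_assoc]

theorem star_elem (a : A) (b : B) : star (elem a b) = elem (star a) (star b) := by
  rw [elem, elem, star_mul, ← map_star, ← map_star, (commute_inl_inr _ _).eq]

theorem elem_one_one : elem (1 : A) (1 : B) = 1 := by
  rw [elem, map_one, map_one, one_mul]

theorem elem_zero_left (b : B) : elem (0 : A) b = 0 := by
  rw [elem, map_zero, zero_mul]

theorem elem_smul_right (c : ℂ) (a : A) (b : B) : elem a (c • b) = c • elem a b := by
  rw [elem, map_smul, mul_smul_comm, elem]

theorem elem_add_left (a a' : A) (b : B) : elem (a + a') b = elem a b + elem a' b := by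
  rw [elem, map_add, add_mul]; rfl

theorem elem_sub_left (a a' : A) (b : B) : elem (a - a') b = elem a b - elem a' b := by
  rw [elem, map_sub, sub_mul]; rfl

theorem elem_sub_right (a : A) (b b' : B) : elem a (b - b') = elem a b - elem a b' := by
  rw [elem, map_sub, mul_sub]; rfl

end UnitalTensor

/-! ### The model isometries, from a unitary `a`, a projection `p`, an isometry `s` and a unitary
`l`. -/

section Model

open UnitalTensor

/-- The isometry `U` of the model representation. -/
def modelU {A B : Type} [CStarAlgebra A] [CStarAlgebra B] (a p : A) (s l : B) :
    UnitalTensor A B := elem (a * (1 - p)) l + elem (a * p) (s * l)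

/-- The isometry `V` of the model representation. -/
def modelV {A B : Type} [CStarAlgebra A] [CStarAlgebra B] (z : ℂ) (a p : A) (s l : B) :
    UnitalTensor A B :=
  elem (p * star a) (star l) + conj z • elem ((1 - p) * star a) (s * star l)

variable {A B : Type} [CStarAlgebra A] [CStarAlgebra B] {z : ℂ} {a p : A} {s l : B}

theorem star_modelU (hp : star p = p) :
    star (modelU a p s l) = elem ((1 - p) * star a) (star l) +
      elem (p * star a) (star l * star s) := by
  rw [modelU, star_add, star_elem, star_elem, star_mul, star_mul, star_mul, star_sub, star_one, hp]

theorem star_modelV (hp : star p = p) :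
    star (modelV z a p s l) = elem (a * p) l + z • elem (a * (1 - p)) (l * star s) := by
  rw [modelV, star_add, star_smul, star_elem, star_elem, star_mul, star_mul, star_mul, star_sub,
    star_one, hp, star_star, star_star, Complex.star_def, Complex.conj_conj]

/-- These products and those of the next lemma are the coefficients in the first tensor factor of
products of model operators: the cross terms vanish as `p` and `1 - p` are orthogonal. -/
theorem unitary_proj_relations (ha : star a * a = 1) (hpp : p * p = p) :
    (1 - p) * star a * (a * (1 - p)) = 1 - p ∧ (1 - p) * star a * (a * p) = 0 ∧
    p * star a * (a * (1 - p)) = 0 ∧ p * star a * (a * p) = p := by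
  have h : ∀ x y : A, x * star a * (a * y) = x * y := fun x y => by
    rw [mul_assoc, ← mul_assoc (star a), ha, one_mul]
  refine ⟨?_, ?_, ?_, ?_⟩ <;> rw [h] <;> simp [mul_sub, sub_mul, hpp]

theorem proj_unitary_relations (hpp : p * p = p) :
    a * (1 - p) * ((1 - p) * star a) = a * (1 - p) * star a ∧ a * (1 - p) * (p * star a) = 0 ∧
    a * p * ((1 - p) * star a) = 0 ∧ a * p * (p * star a) = a * p * star a := by
  have h : ∀ x y : A, a * x * (y * star a) = a * (x * y) * star a := fun x y => by
    simp only [mul_assoc]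
  refine ⟨?_, ?_, ?_, ?_⟩ <;> rw [h] <;> simp [mul_sub, sub_mul, hpp]

theorem proj_unitary_add (ha : a * star a = 1) : a * (1 - p) * star a + a * p * star a = 1 := by
  rw [← add_mul, ← mul_add, sub_add_cancel, mul_one, ha]

theorem star_modelU_mul_modelU (ha : star a * a = 1) (hp : star p = p) (hpp : p * p = p)
    (hs : star s * s = 1) (hl : star l * l = 1) :
    star (modelU a p s l) * modelU a p s l = 1 := by
  obtain ⟨h1, h2, h3, h4⟩ := unitary_proj_relations ha hpp
  have h5 : star l * star s * (s * l) = 1 := by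
    rw [mul_assoc, ← mul_assoc (star s), hs, one_mul, hl]
  rw [star_modelU hp, modelU]
  simp only [add_mul, mul_add, elem_mul_elem, h1, h2, h3, h4, h5, hl, elem_zero_left, add_zero,
    zero_add]
  rw [← elem_add_left, sub_add_cancel, elem_one_one]

theorem star_modelV_mul_modelV (hz : z * conj z = 1) (ha' : a * star a = 1) (hp : star p = p)
    (hpp : p * p = p) (hs : star s * s = 1) (hl' : l * star l = 1) :
    star (modelV z a p s l) * modelV z a p s l = 1 := by
  obtain ⟨h1, h2, h3, h4⟩ := proj_unitary_relations (a := a) hpp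
  have h5 : l * star s * (s * star l) = 1 := by
    rw [mul_assoc, ← mul_assoc (star s), hs, one_mul, hl']
  have hz' : conj z * z = 1 := (mul_comm _ _).trans hz
  rw [star_modelV hp, modelV]
  simp only [add_mul, mul_add, smul_mul_assoc, mul_smul_comm, elem_mul_elem, h1, h2, h3, h4, h5,
    hl', elem_zero_left, smul_zero, add_zero, zero_add, smul_smul, hz', one_smul]
  rw [← elem_add_left, add_comm, proj_unitary_add ha', elem_one_one]

/-- The twist relation is obtained through a common value: `UV` and `z VU` both equal `1 ⊗ s`. This
also gives the image of `w`. -/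
theorem modelU_mul_modelV (hz : z * conj z = 1) (ha' : a * star a = 1)
    (hpp : p * p = p) (hl' : l * star l = 1) (hls : l * s = z • (s * l)) :
    modelU a p s l * modelV z a p s l = elem 1 s := by
  obtain ⟨h1, h2, h3, h4⟩ := proj_unitary_relations (a := a) hpp
  have h5 : l * (s * star l) = z • s := by
    rw [← mul_assoc, hls, smul_mul_assoc, mul_assoc, hl', mul_one]
  have h6 : s * l * star l = s := by rw [mul_assoc, hl', mul_one]
  rw [modelU, modelV]
  simp only [add_mul, mul_add, mul_smul_comm, elem_mul_elem, h1, h2, h3, h4, h5, h6,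
    elem_zero_left, add_zero, zero_add, elem_smul_right, smul_smul]
  rw [mul_comm, hz, one_smul, ← elem_add_left, add_comm, proj_unitary_add ha']

theorem modelV_mul_modelU (hz : z * conj z = 1) (ha : star a * a = 1)
    (hpp : p * p = p) (hl : star l * l = 1) (hls : l * s = z • (s * l)) :
    z • (modelV z a p s l * modelU a p s l) = elem 1 s := by
  obtain ⟨h1, h2, h3, h4⟩ := unitary_proj_relations ha hpp
  have h5 : star l * (s * l) = conj z • s := by
    have h7 : s * l = conj z • (l * s) := by
      rw [hls, smul_smul, mul_comm, hz, one_smul]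
    rw [h7, mul_smul_comm, ← mul_assoc, hl, one_mul]
  have h6 : s * star l * l = s := by rw [mul_assoc, hl, mul_one]
  rw [modelU, modelV]
  simp only [add_mul, mul_add, smul_mul_assoc, elem_mul_elem, h1, h2, h3, h4, h5, h6,
    elem_zero_left, smul_zero, add_zero, zero_add, elem_smul_right, smul_add, smul_smul, hz,
    one_smul]
  rw [← elem_add_left, sub_add_cancel]

theorem one_sub_modelU_mul_star (ha' : a * star a = 1) (hp : star p = p)
    (hpp : p * p = p) (hl' : l * star l = 1) :
    1 - modelU a p s l * star (modelU a p s l) = elem (a * p * star a) (1 - s * star s) := by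
  obtain ⟨h1, h2, h3, h4⟩ := proj_unitary_relations (a := a) hpp
  have h5 : s * l * (star l * star s) = s * star s := by
    rw [mul_assoc, ← mul_assoc l, hl', one_mul]
  rw [star_modelU hp, modelU]
  simp only [add_mul, mul_add, elem_mul_elem, h1, h2, h3, h4, h5, hl', elem_zero_left, add_zero,
    zero_add]
  have h6 : elem (1 : A) (1 : B) = elem (a * (1 - p) * star a) 1 + elem (a * p * star a) 1 := by
    rw [← elem_add_left, proj_unitary_add ha']
  rw [elem_sub_right, ← elem_one_one, h6]
  abel

theorem one_sub_modelV_mul_star (hz : z * conj z = 1) (ha : star a * a = 1) (hp : star p = p)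
    (hpp : p * p = p) (hl : star l * l = 1) :
    1 - modelV z a p s l * star (modelV z a p s l) = elem (1 - p) (1 - s * star s) := by
  obtain ⟨h1, h2, h3, h4⟩ := unitary_proj_relations ha hpp
  have h5 : s * star l * (l * star s) = s * star s := by
    rw [mul_assoc, ← mul_assoc (star l), hl, one_mul]
  rw [star_modelV hp, modelV]
  simp only [add_mul, mul_add, smul_mul_assoc, mul_smul_comm, elem_mul_elem, h1, h2, h3, h4, h5,
    hl, elem_zero_left, smul_zero, add_zero, zero_add, smul_smul, hz, one_smul]
  rw [elem_sub_right, ← elem_one_one, elem_sub_left 1 p 1]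
  abel

/-- The defects carry the factor `e`, which absorbs `l` on either side. The first summand becomes
`a(1 - p) ⊗ e` and the second `ap ⊗ e`; the terms with a shift die by orthogonality of `p` and `1 -
p`. -/
theorem model_ubar (hz : z * conj z = 1) (ha : star a * a = 1) (ha' : a * star a = 1)
    (hp : star p = p) (hpp : p * p = p) (hl : star l * l = 1)
    (hl' : l * star l = 1) {e : B} (he : 1 - s * star s = e)
    (hel : e * l = e) (hle : l * e = e) :
    modelU a p s l * (1 - modelV z a p s l * star (modelV z a p s l)) +
      (1 - modelU a p s l * star (modelU a p s l)) * star (modelV z a p s l) = elem a e := by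
  have h1 : a * (1 - p) * (1 - p) = a * (1 - p) := by simp [mul_sub, sub_mul, mul_assoc, hpp]
  have h2 : a * p * (1 - p) = 0 := by simp [mul_sub, mul_assoc, hpp]
  have h3 : ∀ x, a * p * star a * (a * x) = a * (p * x) := fun x => by
    rw [mul_assoc (a * p), ← mul_assoc (star a), ha, one_mul, mul_assoc]
  have h4 : p * (1 - p) = 0 := by simp [mul_sub, hpp]
  rw [one_sub_modelV_mul_star hz ha hp hpp hl, one_sub_modelU_mul_star ha' hp hpp hl', he,
    star_modelV hp, modelU]
  simp only [add_mul, mul_add, mul_smul_comm, elem_mul_elem, h1, h2, h3, h4, hpp, hle, hel,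
    mul_zero, elem_zero_left, smul_zero, add_zero]
  rw [← elem_add_left, ← mul_add, sub_add_cancel, mul_one]

theorem model_pbar (ha : star a * a = 1) (ha' : a * star a = 1) (hp : star p = p)
    (hpp : p * p = p) (hl' : l * star l = 1) {e : B}
    (he : 1 - s * star s = e) (hel : e * l = e) (hle : star l * e = e) :
    modelV z a p s l * (1 - modelU a p s l * star (modelU a p s l)) * star (modelV z a p s l) =
      elem p e := by
  have h3 : ∀ x, x * star a * (a * p * star a) = x * p * star a := fun x => by
    rw [mul_assoc, mul_assoc a, ← mul_assoc (star a), ha, one_mul, mul_assoc]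
  have h4 : (1 - p) * p = 0 := by simp [sub_mul, hpp]
  have h5 : p * (1 - p) = 0 := by simp [mul_sub, hpp]
  have h6 : ∀ x, p * star a * (a * x) = p * x := fun x => by
    rw [mul_assoc, ← mul_assoc (star a), ha, one_mul]
  rw [one_sub_modelU_mul_star ha' hp hpp hl', he, star_modelV hp, modelV]
  simp only [add_mul, mul_add, smul_mul_assoc, mul_smul_comm, elem_mul_elem, h3, h4, h5, h6, hpp,
    hle, hel, zero_mul, elem_zero_left, smul_zero, add_zero]

end Model

/-! ### The model representation and its values on the matrix columns. -/

section Representation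

open UnitalTensor

theorem star_baseProj : star baseProj = baseProj := star_rankOne _ _

/-- The representation of the free twist on `(C(S¹) *_ℂ ℂ²) ⊗ B(ℓ²)`. -/
theorem FreeTwist.exists_model (θ : ℝ) :
    ∃ α : FreeTwist θ →⋆ₐ[ℂ] UnitalTensor CircleFreeC2 (Ell2 →L[ℂ] Ell2),
      α (w θ) = elem 1 shift ∧ α (ubar θ) = elem CircleFreeC2.ubar baseProj ∧
        α (pbar θ) = elem CircleFreeC2.pbar baseProj := by
  have hz := rot_mul_conj_rot θ
  have ha := CircleFreeC2.star_ubar_mul_ubar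
  have ha' := CircleFreeC2.ubar_mul_star_ubar
  have hp := CircleFreeC2.star_pbar
  have hpp := CircleFreeC2.pbar_mul_pbar
  have hs := star_shift_mul_shift
  have hl := star_diagRot_mul_diagRot (norm_rot θ)
  have hl' := diagRot_mul_star_diagRot (norm_rot θ)
  have hls := diagRot_mul_shift (norm_rot θ)
  have hle := diagRot_mul_baseProj (norm_rot θ)
  have hle' : star (diagRot (norm_rot θ)) * baseProj = baseProj := by
    conv_lhs => rw [← hle, ← mul_assoc, hl, one_mul]
  have hel : baseProj * diagRot (norm_rot θ) = baseProj := by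
    have := congrArg star hle'
    rwa [star_mul, star_star, star_baseProj] at this
  have he := one_sub_shift_mul_star
  -- From here only the collected algebraic relations of the rotation matter.
  generalize diagRot (norm_rot θ) = l at hl hl' hls hle hle' hel
  have hy : IsRep (freeTwistRels θ) (fun b : Bool => cond b
      (modelV (rot θ) CircleFreeC2.ubar CircleFreeC2.pbar shift l)
      (modelU CircleFreeC2.ubar CircleFreeC2.pbar shift l)) := by
    rintro r (rfl | rfl | rfl)
    · simp [star_modelU_mul_modelU ha hp hpp hs hl]
    · simp [star_modelV_mul_modelV hz ha' hp hpp hs hl']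
    · rw [map_sub, map_smul, map_mul, map_mul, StarPoly.eval_gen, StarPoly.eval_gen, sub_eq_zero]
      exact (modelU_mul_modelV hz ha' hpp hl' hls).trans (modelV_mul_modelU hz ha hpp hl hls).symm
  let α := UnivCStar.lift _ _ hy
  have hu : α (u θ) = modelU CircleFreeC2.ubar CircleFreeC2.pbar shift l :=
    UnivCStar.lift_of _ _ hy false
  have hv : α (v θ) = modelV (rot θ) CircleFreeC2.ubar CircleFreeC2.pbar shift l :=
    UnivCStar.lift_of _ _ hy true
  refine ⟨α, ?_, ?_, ?_⟩
  · rw [w, map_mul, hu, hv]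
    exact modelU_mul_modelV hz ha' hpp hl' hls
  · rw [ubar, map_add, map_mul, map_mul, map_sub, map_sub, map_mul, map_mul, map_star, map_star,
      map_one, hu, hv]
    exact model_ubar hz ha ha' hp hpp hl hl' he hel hle
  · rw [pbar, map_mul, map_mul, map_sub, map_mul, map_star, map_star, map_one, hu, hv]
    exact model_pbar ha ha' hp hpp hl' he hel hle'

variable {θ : ℝ} {α : FreeTwist θ →⋆ₐ[ℂ] UnitalTensor CircleFreeC2 (Ell2 →L[ℂ] Ell2)}

theorem FreeTwist.model_q (hw : α (w θ) = elem 1 shift) : α (q θ) = elem 1 baseProj := by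
  rw [q, map_sub, map_mul, map_star, map_one, hw, star_elem, elem_mul_elem, star_one, one_mul,
    ← elem_one_one, ← elem_sub_right, one_sub_shift_mul_star]

/-- The unital homomorphisms `α ∘ cornerHom` and `d ↦ d ⊗ 1` need not agree, since `ū + (1 - q)`
goes to `ū ⊗ e₀₀ + 1 ⊗ ss*`. They agree on both generators after cutting by `1 ⊗ e₀₀`, the image of
`q`, and this suffices because both ranges commute with that projection. -/
theorem FreeTwist.model_corner (hw : α (w θ) = elem 1 shift)
    (hu : α (ubar θ) = elem CircleFreeC2.ubar baseProj)
    (hp : α (pbar θ) = elem CircleFreeC2.pbar baseProj) (d : CircleFreeC2) :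
    α (corner θ d) = elem d baseProj := by
  have hq := model_q hw
  have he : elem (1 : CircleFreeC2) baseProj = inr _ _ baseProj := by rw [elem, map_one, one_mul]
  have h : ∀ d, Commute (α (cornerHom θ d)) (elem 1 baseProj) := fun d => by
    rw [← hq]
    exact (commute_cornerHom_q θ d).map α
  have hx : ∀ d, α (cornerHom θ d) * elem 1 baseProj = α (corner θ d) := fun d => by
    rw [← hq, ← map_mul, corner_apply]
  have := CircleFreeC2.hom_mul_eq (α.comp (cornerHom θ)) (inl _ _) (e := elem 1 baseProj)
    (by rw [star_elem, star_one, star_baseProj]) h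
    (fun d => by rw [he]; exact commute_inl_inr _ _)
    ((hx _).trans (by rw [corner_ubar, hu, he, elem]))
    ((hx _).trans (by rw [corner_pbar, hp, he, elem])) d
  rw [← hx]
  refine Eq.trans this ?_
  rw [he, elem]

theorem FreeTwist.model_col_mul_corner (hw : α (w θ) = elem 1 shift)
    (hc : ∀ d, α (corner θ d) = elem d baseProj) (i : ℕ) (d : CircleFreeC2) :
    α (w θ ^ i * corner θ d) = elem d (matrixCol i : Ell2 →L[ℂ] Ell2) := by
  have hwi : α (w θ ^ i) = elem 1 (shift ^ i) := by
    rw [map_pow, hw]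
    induction i with
    | zero => rw [pow_zero, pow_zero, elem_one_one]
    | succ i ih => rw [pow_succ, ih, elem_mul_elem, one_mul, pow_succ]
  rw [map_mul, hwi, hc, elem_mul_elem, one_mul, coe_matrixCol_eq]

end Representation

end TwistedIsometries

end

noncomputable section

namespace TwistedIsometries

/-! ### Comparison inside `D ⊗ B(ℓ²)` and the isomorphism. -/

section Isomorphism

open UnitalTensor

/-- This supplies faithfulness on both corners, as each is sent to the tensors `d ⊗ e₀₀`. -/
theorem eq_zero_of_elem_baseProj_eq_zero {D : Type} [CStarAlgebra D] {d : D}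
    (h : elem d baseProj = 0) : d = 0 := by
  by_contra hd
  exact inl_mul_inr_ne_zero hd baseProj_ne_zero h

variable {θ : ℝ} {α : FreeTwist θ →⋆ₐ[ℂ] UnitalTensor CircleFreeC2 (Ell2 →L[ℂ] Ell2)}
  {β : TensorAmbient CircleFreeC2 Compacts →⋆ₐ[ℂ] UnitalTensor CircleFreeC2 (Ell2 →L[ℂ] Ell2)}

theorem FreeTwist.model_generator
    (hcol : ∀ i d, α (w θ ^ i * corner θ d) = elem d (matrixCol i : Ell2 →L[ℂ] Ell2))
    (i j : ℕ) (d : CircleFreeC2) : α (col θ i * corner θ d * star (col θ j)) =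
      elem d ((matrixCol i * star (matrixCol j) : Compacts) : Ell2 →L[ℂ] Ell2) := by
  have h : α (col θ j) = elem 1 (matrixCol j : Ell2 →L[ℂ] Ell2) := by
    rw [col, ← corner_one, hcol]
  rw [col_mul_corner, map_mul, map_star, hcol, h, star_elem, elem_mul_elem, star_one, mul_one]
  rfl

/-- Both maps send the generator indexed by `i`, `j`, `d` to `d ⊗ x_i x_j*`. The isomorphism is
characterised by equality of images, which makes its values on `d ⊗ x_i` readable. -/
theorem exists_starAlgEquiv_of_models
    (hcol : ∀ i d, α (FreeTwist.w θ ^ i * FreeTwist.corner θ d) =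
      elem d (matrixCol i : Ell2 →L[ℂ] Ell2))
    (hβ : ∀ d k, β (preTmul d k) = elem d (k : Ell2 →L[ℂ] Ell2)) :
    ∃ Φ : FreeTwist.defectIdeal θ ≃⋆ₐ[ℂ] CStarTensor CircleFreeC2 Compacts,
      ∀ x ∈ FreeTwist.defectIdeal θ, ∀ y : CStarTensor CircleFreeC2 Compacts,
        β y = α x → (Φ.symm y : FreeTwist θ) = x := by
  refine exists_starAlgEquiv_of_cornerSpan (FreeTwist.defectIdeal_eq θ)
    (TensorAmbient.cStarTensor_eq CircleFreeC2) (FreeTwist.star_col_mul_col θ)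
    TensorAmbient.star_col_mul_col α β (fun d h => eq_zero_of_elem_baseProj_eq_zero ?_)
    (fun d h => eq_zero_of_elem_baseProj_eq_zero ?_) fun i j d => ?_
  · rw [← h, ← one_mul (FreeTwist.corner θ d), ← pow_zero (FreeTwist.w θ), hcol]
    rfl
  · rw [← h]
    exact (hβ d (matrixCol 0)).symm
  · rw [TensorAmbient.col_mul_corner_mul_star, hβ, FreeTwist.model_generator hcol]

theorem FreeTwist.pow_mul_corner_mem_defectIdeal (θ : ℝ) (i : ℕ) (d : CircleFreeC2) :
    w θ ^ i * corner θ d ∈ defectIdeal θ := by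
  rw [← q_mul_corner]
  exact mul_mem_closedIdeal_left _ (mul_mem_closedIdeal_right _ (q_mem_defectIdeal θ))

theorem FreeTwist.exists_model_col (θ : ℝ) :
    ∃ α : FreeTwist θ →⋆ₐ[ℂ] UnitalTensor CircleFreeC2 (Ell2 →L[ℂ] Ell2),
      ∀ i d, α (w θ ^ i * corner θ d) = elem d (matrixCol i : Ell2 →L[ℂ] Ell2) :=
  (exists_model θ).imp fun _ h => model_col_mul_corner h.1 (model_corner h.1 h.2.1 h.2.2)

/-- The defect ideal of the free twist is the stabilisation of `C(S¹) *_ℂ ℂ²`. -/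
theorem FreeTwist.exists_defectIdeal_starAlgEquiv (θ : ℝ) :
    ∃ Φ : defectIdeal θ ≃⋆ₐ[ℂ] CStarTensor CircleFreeC2 Compacts,
      ∀ i d, (Φ.symm (tmul d (matrixCol i)) : FreeTwist θ) = w θ ^ i * corner θ d :=
  (exists_model_col θ).elim fun _ hcol => (TensorAmbient.exists_toUnitalTensor CircleFreeC2).elim
    fun _ hβ => (exists_starAlgEquiv_of_models hcol hβ).imp fun _ hΦ i d =>
      hΦ _ (pow_mul_corner_mem_defectIdeal θ i d) (tmul d (matrixCol i))
        ((hβ d (matrixCol i)).trans (hcol i d).symm)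

theorem FreeTwist.pow_mul_ubar_eq (θ : ℝ) (i : ℕ) :
    (u θ * v θ) ^ i * ubar θ = w θ ^ i * corner θ CircleFreeC2.ubar := by
  rw [corner_ubar, w]

theorem FreeTwist.pow_mul_pbar_eq (θ : ℝ) (i : ℕ) :
    (u θ * v θ) ^ i * pbar θ = w θ ^ i * corner θ CircleFreeC2.pbar := by
  rw [corner_pbar, w]

end Isomorphism

end TwistedIsometries

end

open TwistedIsometries in
theorem mainTheorem5 (θ : ℝ) :
    ∃ Φ : FreeTwist.defectIdeal θ ≃⋆ₐ[ℂ] CStarTensor CircleFreeC2 Compacts,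
      ∀ i : ℕ,
        (Φ.symm (tmul CircleFreeC2.ubar (matrixCol i)) : FreeTwist θ) =
            (FreeTwist.u θ * FreeTwist.v θ) ^ i * FreeTwist.ubar θ ∧
        (Φ.symm (tmul CircleFreeC2.pbar (matrixCol i)) : FreeTwist θ) =
            (FreeTwist.u θ * FreeTwist.v θ) ^ i * FreeTwist.pbar θ := by
  refine (FreeTwist.exists_defectIdeal_starAlgEquiv θ).imp fun Φ hΦ i => ?_
  exact ⟨(hΦ i _).trans (FreeTwist.pow_mul_ubar_eq θ i).symm,
    (hΦ i _).trans (FreeTwist.pow_mul_pbar_eq θ i).symm⟩
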